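/- Let $P(z)=p_nz^n+\cdots+p_0$ be a complex polynomial of degree $n\ge 1$, $p_n\neq0$, and put $$q=\frac{n+2}{2},\qquad d=\frac{p_n^{1/2}}{q},\qquad \theta_j=\frac{2\pi j-\arg p_n}{n+2}\quad(j\in\mathbb Z),$$ where $-\pi<\arg p_n\le\pi$ and $p_n^{1/2}=\sqrt{|p_n|}\,e^{i\arg(p_n)/2}$. The rays $\arg z=\theta_j$ are the critical rays (since $\theta_{j+n+2}=\theta_j+2\pi$, there are $n+2$ of them), and $S(\theta_{j-1},\theta_j)=\{re^{i\theta}: r>0,\ \theta_{j-1}<\theta<\theta_j\}$ are the open sectors between consecutive critical rays. On $S(\theta_{j-1},\theta_j)$ let $z^q$ denote the branch $(re^{i\theta})^q=r^qe^{iq\theta}$, $\theta_{j-1}<\theta<\theta_j$. An entire function $f$ is said to blow up exponentially on the ray $\arg z=\theta$ if $\liminf_{r\to\infty}r^{-q}\log|f(re^{i\theta})|>0$, and to decay exponentially to zero on this ray if $\liminf_{r\to\infty}r^{-q}\log\bigl(1/|f(re^{i\theta})|\bigr)>0$. Let $f\not\equiv0$ be a solution of $f''+P(z)f=0$ in $\mathbb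 C$; it is an entire function. (a) In each sector $S=S(\theta_{j-1},\theta_j)$, either (i) $f$ blows up exponentially on every ray in $S$, or (ii) $f$ decays exponentially to zero on every ray in $S$. Moreover, there is a sign $\sigma\in\{1,-1\}$, the same for all rays in $S$, such that on every ray $\arg z=\theta$ in $S$ $$f(z)=\exp\{\sigma\, i\,d\,z^q(1+o(1))\},\qquad |z|\to\infty,$$ that is, $f$ is asymptotically comparable to $E_1(z)=\exp\{idz^q(1+o(1))\}$ on all rays in $S$, or to $E_2(z)=\exp\{-idz^q(1+o(1))\}$ on all rays in $S$. In each such sector $S$ there exist non-trivial solutions of $f''+P(z)f=0$ of both types (i) and (ii). (b) For every $j$, there do not exist a ray in $S(\theta_{j-1},\theta_j)$ and a ray in $S(\theta_j,\theta_{j+1})$ such that $f$ decays exponentially to zero on both rays. -/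

import Mathlib

open Filter Topology

namespace PolyODE

/-- `f` is a non-trivial (entire) solution of `f'' + P f = 0` in the complex plane. -/
def IsNontrivialSolution (P : Polynomial ℂ) (f : ℂ → ℂ) : Prop :=
  Differentiable ℂ f ∧ (∀ z : ℂ, deriv (deriv f) z + P.eval z * f z = 0) ∧ f ≠ 0

/-- The point `r e^{iθ}`. -/
noncomputable def polarPoint (θ r : ℝ) : ℂ :=
  (r : ℂ) * Complex.exp ((θ : ℂ) * Complex.I)

/-- The exponent `q = (n + 2) / 2`, where `n` is the degree of `P`. -/
noncomputable def q (P : Polynomial ℂ) : ℝ :=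
  ((P.natDegree : ℝ) + 2) / 2

/-- The angles `θ_j = (2πj - arg p_n) / (n + 2)` of the critical rays, with `-π < arg p_n ≤ π`.
The index `j` runs through all integers; `θ_{j+n+2} = θ_j + 2π` belongs to the same ray. -/
noncomputable def criticalAngle (P : Polynomial ℂ) (j : ℤ) : ℝ :=
  (2 * Real.pi * (j : ℝ) - Complex.arg P.leadingCoeff) / ((P.natDegree : ℝ) + 2)

/-- The angles of the rays in the open sector `S(θ_{j-1}, θ_j)`. -/
def sectorAngles (P : Polynomial ℂ) (j : ℤ) : Set ℝ :=
  Set.Ioo (criticalAngle P (j - 1)) (criticalAngle P j)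

/-- The constant `d = p_n^{1/2} / q` with the principal square root
`p_n^{1/2} = √|p_n| exp(i arg(p_n) / 2)`. -/
noncomputable def d (P : Polynomial ℂ) : ℂ :=
  ((Real.sqrt ‖P.leadingCoeff‖ : ℝ) : ℂ) *
    Complex.exp (Complex.I * ((Complex.arg P.leadingCoeff : ℝ) : ℂ) / 2) / ((q P : ℝ) : ℂ)

/-- The value at `z = r e^{iθ}` of the branch `z^q = r^q e^{iqθ}`. For `θ` in an interval
`(θ_{j-1}, θ_j)` this is a continuous branch of `z^q` on the sector; replacing `j` by `j + n + 2`
gives the other branch (if there is another one). -/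
noncomputable def powQ (P : Polynomial ℂ) (θ r : ℝ) : ℂ :=
  ((r ^ q P : ℝ) : ℂ) * Complex.exp (Complex.I * ((q P * θ : ℝ) : ℂ))

/-- `f` blows up exponentially on the ray `arg z = θ`:
`liminf_{r → ∞} r^{-q} log |f(r e^{iθ})| > 0`. Here `log 0 = -∞` and the `liminf` is taken
in the extended reals. -/
def BlowsUpOnRay (P : Polynomial ℂ) (f : ℂ → ℂ) (θ : ℝ) : Prop :=
  0 < liminf (fun r : ℝ => ((r ^ (-q P) : ℝ) : EReal) * ENNReal.log ‖f (polarPoint θ r)‖ₑ) atTop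

/-- `f` decays exponentially to zero on the ray `arg z = θ`:
`liminf_{r → ∞} r^{-q} log (1 / |f(r e^{iθ})|) > 0`, where `log (1 / 0) = ∞`. -/
def DecaysOnRay (P : Polynomial ℂ) (f : ℂ → ℂ) (θ : ℝ) : Prop :=
  0 < liminf (fun r : ℝ => ((r ^ (-q P) : ℝ) : EReal) * ENNReal.log (‖f (polarPoint θ r)‖ₑ)⁻¹) atTop

/-- On the ray `arg z = θ`, `f` has the form `exp {σ i d z^q (1 + o(1))}` as `z → ∞`; the signs
`σ = 1` and `σ = -1` give `E₁` and `E₂`. A factor that is bounded and bounded away from zero is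
absorbed in the `o(1)`, so that this is the same as being comparable to such a function. -/
def AsymptoticOnRay (P : Polynomial ℂ) (σ : ℂ) (f : ℂ → ℂ) (θ : ℝ) : Prop :=
  ∃ ε : ℝ → ℂ, Tendsto ε atTop (𝓝 0) ∧
    ∀ᶠ r : ℝ in atTop,
      f (polarPoint θ r) = Complex.exp (σ * Complex.I * d P * powQ P θ r * (1 + ε r))

end PolyODE

namespace PolyODE

/-! On the sector with index j use the coordinate w = (-1)^j i d z^q, with inverse `coordMap`. The
sector becomes the right half-plane, and the slit plane reaches half-way into both neighbouring
sectors. For F(w) = f(z(w)) the equation reads F'' = (1 + E₁) F + E₂ F' with E₁, E₂ → 0 at infinity,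
a perturbation of F'' = F. On each ray off the imaginary axis F'/F tends to 1 or to -1, as for e^w
and e^{-w}; integrating F'/F gives f = exp(±w(1 + o(1))) (`RaySystem.exists_exp_form`), and growth
or decay is read off from this.

Everything rests on the form N_δ = δ|F + F'|² - |F - F'|². Far out it increases strictly in every
direction whose angle with the positive real axis stays away from π/2
(`exists_coneDeriv_lower_bound`). Along one ray, monotonicity for all δ forces the dichotomy
(`RaySystem.ratioTendsto`). The sign of N_1 is that of Re(F'/F), so a segment running rightwards,
far out, from a point with N_1 > 0 to one with N_1 < 0 is impossible. Hence all rays of the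
half-plane have one type (`PlaneSystem.ratioTendsto_neg_one`), and decay on both sides of the
imaginary axis cannot occur (`PlaneSystem.not_decay_both_sides`), which is (b).

A growing solution starts far out with N_1 > 0. A decaying one is a limit, by compactness, of
solutions vanishing at ever more distant points of the positive axis
(`exists_decaying_combination`). -/

/-! ### Entire solutions of the initial value problem. -/

/-- The Taylor coefficients at `0` of the solution of `f'' + P f = 0` with `f 0 = a`, `f' 0 = b`. -/
noncomputable def seriesCoeff (P : Polynomial ℂ) (a b : ℂ) : ℕ → ℂ
  | 0 => a
  | 1 => b
  | k + 2 => -(∑ i : Fin (k + 1), seriesCoeff P a b i * P.coeff (k - i)) / ((k + 2) * (k + 1))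

lemma seriesCoeff_add_two (P : Polynomial ℂ) (a b : ℂ) (k : ℕ) :
    ((k : ℂ) + 1) * (((k : ℂ) + 2) * seriesCoeff P a b (k + 2)) =
      -∑ x ∈ Finset.HasAntidiagonal.antidiagonal k, seriesCoeff P a b x.1 * P.coeff x.2 := by
  have h1 : (k : ℂ) + 1 ≠ 0 := by exact_mod_cast Nat.succ_ne_zero k
  have h2 : (k : ℂ) + 2 ≠ 0 := by exact_mod_cast Nat.succ_ne_zero (k + 1)
  rw [Finset.Nat.sum_antidiagonal_eq_sum_range_succ
    (fun i j => seriesCoeff P a b i * P.coeff j), Finset.sum_range, seriesCoeff]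
  field_simp

/-- The factor (k + 1)(k + 2) in the recursion eventually exceeds the constant ρ²A produced by
convolution with P, so a bound on the earlier terms passes to the next one. As ρ is arbitrary, the
radius of convergence is infinite. -/
lemma seriesCoeff_bounded (P : Polynomial ℂ) (a b : ℂ) {ρ : ℝ} (hρ : 0 < ρ) :
    ∃ M : ℝ, ∀ k, ‖seriesCoeff P a b k‖ * ρ ^ k ≤ M := by
  set c := seriesCoeff P a b with hc
  set A : ℝ := ∑ i ∈ Finset.range (P.natDegree + 1), ‖P.coeff i‖ * ρ ^ i with hA
  have hA0 : 0 ≤ A := Finset.sum_nonneg fun i _ => by positivity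
  have hsum : ∀ k, ∑ x ∈ Finset.HasAntidiagonal.antidiagonal k, ‖P.coeff x.2‖ * ρ ^ x.2 ≤ A := by
    intro k
    rw [← Finset.Nat.sum_antidiagonal_swap, Finset.Nat.sum_antidiagonal_eq_sum_range_succ_mk]
    simp only [Prod.snd_swap]
    calc ∑ i ∈ Finset.range (k + 1), ‖P.coeff i‖ * ρ ^ i
        ≤ ∑ i ∈ Finset.range (k + 1) ∪ Finset.range (P.natDegree + 1), ‖P.coeff i‖ * ρ ^ i :=
          Finset.sum_le_sum_of_subset_of_nonneg Finset.subset_union_left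
            fun i _ _ => by positivity
      _ = A := by
          refine (Finset.sum_subset Finset.subset_union_right fun i _ hi => ?_).symm
          rw [Polynomial.coeff_eq_zero_of_natDegree_lt (by simpa using hi)]
          simp
  -- From index K + 2 on, the recursion no longer increases the bound; the finitely many earlier
  -- terms are put into M.
  obtain ⟨K, hK⟩ := exists_nat_ge (ρ ^ 2 * A)
  refine ⟨∑ i ∈ Finset.range (K + 2), ‖c i‖ * ρ ^ i, fun k => ?_⟩
  set M : ℝ := ∑ i ∈ Finset.range (K + 2), ‖c i‖ * ρ ^ i
  have hM0 : 0 ≤ M := Finset.sum_nonneg fun i _ => by positivity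
  induction k using Nat.strong_induction_on with
  | _ k ih =>
    rcases lt_or_ge k (K + 2) with hk | hk
    · exact Finset.single_le_sum (f := fun i => ‖c i‖ * ρ ^ i) (fun i _ => by positivity)
        (Finset.mem_range.2 hk)
    · obtain ⟨m, rfl⟩ : ∃ m, k = m + 2 := ⟨k - 2, by omega⟩
      have hrec := congrArg norm (seriesCoeff_add_two P a b m)
      rw [norm_neg, norm_mul, norm_mul] at hrec
      have e1 : ‖(m : ℂ) + 1‖ = m + 1 := by
        rw [← Nat.cast_succ, Complex.norm_natCast]; push_cast; ring
      have e2 : ‖(m : ℂ) + 2‖ = m + 2 := by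
        have : ((m : ℂ) + 2) = ((m + 2 : ℕ) : ℂ) := by push_cast; ring
        rw [this, Complex.norm_natCast]; push_cast; ring
      rw [e1, e2, ← hc] at hrec
      have hbound : ‖∑ x ∈ Finset.HasAntidiagonal.antidiagonal m, c x.1 * P.coeff x.2‖ * ρ ^ m ≤ M * A := by
        calc _ ≤ (∑ x ∈ Finset.HasAntidiagonal.antidiagonal m, ‖c x.1‖ * ‖P.coeff x.2‖) * ρ ^ m := by
              gcongr
              exact (norm_sum_le _ _).trans_eq (by simp)
          _ = ∑ x ∈ Finset.HasAntidiagonal.antidiagonal m, (‖c x.1‖ * ρ ^ x.1) * (‖P.coeff x.2‖ * ρ ^ x.2) := by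
              rw [Finset.sum_mul]
              refine Finset.sum_congr rfl fun x hx => ?_
              rw [← Finset.HasAntidiagonal.mem_antidiagonal.1 hx, pow_add]; ring
          _ ≤ ∑ x ∈ Finset.HasAntidiagonal.antidiagonal m, M * (‖P.coeff x.2‖ * ρ ^ x.2) := by
              refine Finset.sum_le_sum fun x hx => ?_
              have := ih x.1 (by have := Finset.HasAntidiagonal.mem_antidiagonal.1 hx; omega)
              gcongr
          _ ≤ M * A := by rw [← Finset.mul_sum]; gcongr; exact hsum m
      have hm : (K : ℝ) ≤ m := by exact_mod_cast (by omega : K ≤ m)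
      have hpos : (0 : ℝ) < (m + 1) * (m + 2) := by positivity
      have h3 : (m + 1 : ℝ) * (m + 2) * (‖c (m + 2)‖ * ρ ^ (m + 2)) ≤ (m + 1) * (m + 2) * M := by
        calc (m + 1 : ℝ) * (m + 2) * (‖c (m + 2)‖ * ρ ^ (m + 2))
            = ((m + 1) * ((m + 2) * ‖c (m + 2)‖)) * ρ ^ m * ρ ^ 2 := by ring
          _ ≤ M * A * ρ ^ 2 := by rw [hrec]; gcongr
          _ = (ρ ^ 2 * A) * M := by ring
          _ ≤ (m + 1) * (m + 2) * M := by
              refine mul_le_mul_of_nonneg_right ?_ hM0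
              have : (0 : ℝ) ≤ m := by positivity
              nlinarith
      exact le_of_mul_le_mul_left h3 hpos

/-- The left side is one term of the binomial expansion. Enlarging the radius by one thus absorbs
the factor produced by differentiation. -/
lemma succ_mul_pow_le {r : ℝ} (hr : 0 ≤ r) (k : ℕ) : (k + 1 : ℝ) * r ^ k ≤ (r + 1) ^ (k + 1) := by
  have key : r ^ (k + 1) + (k + 1 : ℝ) * r ^ k ≤ (r + 1) ^ (k + 1) := by
    induction k with
    | zero => simp
    | succ k ih =>
      have h := mul_le_mul_of_nonneg_right ih (by linarith : 0 ≤ r + 1)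
      have h' : 0 ≤ (k + 1 : ℝ) * r ^ k := by positivity
      push_cast
      rw [pow_succ (r + 1)]
      refine le_trans ?_ h
      ring_nf at h' ⊢
      linarith
  have : 0 ≤ r ^ (k + 1) := by positivity
  linarith

/-- The summability condition is reproduced for the derived series, so that the lemma can be applied
twice to reach f''. -/
lemma hasDerivAt_entire_series {c : ℕ → ℂ} (hc : ∀ r : ℝ, 0 ≤ r → Summable fun k => ‖c k‖ * r ^ k) :
    (∀ r : ℝ, 0 ≤ r → Summable fun k : ℕ => ‖((k : ℂ) + 1) * c (k + 1)‖ * r ^ k) ∧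
    ∀ z : ℂ, HasDerivAt (fun z => ∑' k, c k * z ^ k)
      (∑' k : ℕ, (((k : ℂ) + 1) * c (k + 1)) * z ^ k) z := by
  have hs : ∀ r : ℝ, 0 ≤ r → Summable fun k : ℕ => ‖((k : ℂ) + 1) * c (k + 1)‖ * r ^ k := by
    intro r hr
    refine Summable.of_nonneg_of_le (fun k => by positivity) (fun k => ?_)
      ((summable_nat_add_iff 1).2 (hc (r + 1) (by linarith)))
    have e1 : ‖(k : ℂ) + 1‖ = k + 1 := by
      rw [← Nat.cast_succ, Complex.norm_natCast]; push_cast; ring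
    rw [norm_mul, e1]
    calc (k + 1 : ℝ) * ‖c (k + 1)‖ * r ^ k = ‖c (k + 1)‖ * ((k + 1) * r ^ k) := by ring
      _ ≤ _ := by gcongr; exact succ_mul_pow_le hr k
  refine ⟨hs, fun z => ?_⟩
  set R : ℝ := ‖z‖ + 1
  have hR : 0 ≤ R := by positivity
  have hsum' : Summable fun k : ℕ => ‖c k‖ * (k * R ^ (k - 1)) := by
    rw [← summable_nat_add_iff 1]
    refine (hs R hR).congr fun k => ?_
    have e1 : ‖(k : ℂ) + 1‖ = k + 1 := by
      rw [← Nat.cast_succ, Complex.norm_natCast]; push_cast; ring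
    rw [norm_mul, e1, Nat.add_sub_cancel]; push_cast; ring
  have h := hasDerivAt_tsum_of_isPreconnected (g := fun k z => c k * z ^ k)
    (g' := fun k z => c k * (k * z ^ (k - 1))) hsum' Metric.isOpen_ball
    (convex_ball (0 : ℂ) R).isPreconnected
    (fun k y _ => (hasDerivAt_pow k y).const_mul (c k))
    (fun k y hy => by
      rw [norm_mul, norm_mul, norm_pow, Complex.norm_natCast]
      have : ‖y‖ ≤ R := (mem_ball_zero_iff.1 hy).le
      gcongr)
    (y₀ := 0) (y := z) (Metric.mem_ball_self (by positivity))
    (summable_of_ne_finset_zero (s := {0}) fun k hk => by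
      simp only [Finset.mem_singleton] at hk; simp [hk])
    (by simp [R])
  have hsz : Summable fun k : ℕ => c k * (k * z ^ (k - 1)) := by
    refine Summable.of_norm_bounded hsum' fun k => ?_
    rw [norm_mul, norm_mul, norm_pow, Complex.norm_natCast]
    have : ‖z‖ ≤ R := by simp [R]
    gcongr
  have e : ∑' k : ℕ, (((k : ℂ) + 1) * c (k + 1)) * z ^ k = ∑' k : ℕ, c k * (k * z ^ (k - 1)) := by
    rw [hsz.tsum_eq_zero_add]
    simp only [Nat.cast_zero, zero_mul, mul_zero, zero_add, Nat.add_sub_cancel]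
    refine tsum_congr fun k => ?_
    push_cast; ring
  rw [e]
  exact h

lemma exists_solution_at_zero (P : Polynomial ℂ) (a b : ℂ) :
    ∃ f : ℂ → ℂ, Differentiable ℂ f ∧ (∀ z, deriv (deriv f) z + P.eval z * f z = 0) ∧
      f 0 = a ∧ deriv f 0 = b := by
  set c := seriesCoeff P a b with hcdef
  have hc : ∀ r : ℝ, 0 ≤ r → Summable fun k => ‖c k‖ * r ^ k := by
    intro r hr
    -- The factor 2 leaves a geometric series; the added 1 keeps the radius positive when r = 0.
    obtain ⟨M, hM⟩ := seriesCoeff_bounded P a b (ρ := 2 * (r + 1)) (by positivity)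
    refine Summable.of_nonneg_of_le (fun k => by positivity) (fun k => ?_)
      (summable_geometric_two.mul_left M)
    calc ‖c k‖ * r ^ k ≤ ‖c k‖ * (r + 1) ^ k := by gcongr; linarith
      _ = (‖c k‖ * (2 * (r + 1)) ^ k) * (1 / 2) ^ k := by
          rw [mul_assoc, ← mul_pow]; congr 2; ring
      _ ≤ M * (1 / 2) ^ k := by gcongr; exact hM k
  obtain ⟨hc1, hd1⟩ := hasDerivAt_entire_series hc
  obtain ⟨hc2, hd2⟩ := hasDerivAt_entire_series hc1
  have e1 := funext fun z => (hd1 z).deriv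
  refine ⟨fun z => ∑' k, c k * z ^ k, fun z => (hd1 z).differentiableAt, fun z => ?_, ?_, ?_⟩
  · rw [e1, (hd2 z).deriv]
    have hP : HasSum (fun k => P.coeff k * z ^ k) (P.eval z) := by
      rw [Polynomial.eval_eq_sum_range]
      refine hasSum_sum_of_ne_finset_zero fun k hk => ?_
      rw [Polynomial.coeff_eq_zero_of_natDegree_lt (by simpa using hk), zero_mul]
    have hPn : Summable fun k => ‖P.coeff k * z ^ k‖ :=
      summable_of_ne_finset_zero (s := Finset.range (P.natDegree + 1)) fun k hk => by
        rw [Polynomial.coeff_eq_zero_of_natDegree_lt (by simpa using hk), zero_mul, norm_zero]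
    have hcn : Summable fun k => ‖c k * z ^ k‖ :=
      (hc ‖z‖ (norm_nonneg z)).congr fun k => by rw [norm_mul, norm_pow]
    rw [mul_comm, ← hP.tsum_eq, tsum_mul_tsum_eq_tsum_sum_antidiagonal_of_summable_norm hcn hPn,
      add_eq_zero_iff_eq_neg, ← tsum_neg]
    refine tsum_congr fun k => ?_
    have h := seriesCoeff_add_two P a b k
    rw [← hcdef] at h
    have h' : ((k : ℂ) + 1) * ((((k + 1 : ℕ) : ℂ) + 1) * c (k + 1 + 1)) =
        ((k : ℂ) + 1) * (((k : ℂ) + 2) * c (k + 2)) := by push_cast; ring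
    rw [h', h, neg_mul, Finset.sum_mul]
    congr 1
    refine Finset.sum_congr rfl fun x hx => ?_
    rw [← Finset.HasAntidiagonal.mem_antidiagonal.1 hx, pow_add]; ring
  · simp only []
    rw [tsum_eq_single 0 fun k hk => by simp [hk]]
    simp [hcdef, seriesCoeff]
  · rw [e1]
    simp only []
    rw [tsum_eq_single 0 fun k hk => by simp [hk]]
    simp [hcdef, seriesCoeff]

/-- The initial value problem for `f'' + P f = 0` has an entire solution. -/
lemma exists_solution (P : Polynomial ℂ) (z₀ a b : ℂ) :
    ∃ f : ℂ → ℂ, Differentiable ℂ f ∧ (∀ z, deriv (deriv f) z + P.eval z * f z = 0) ∧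
      f z₀ = a ∧ deriv f z₀ = b := by
  obtain ⟨f, hf, hode, h0, h1⟩ :=
    exists_solution_at_zero (P.comp (Polynomial.X + Polynomial.C z₀)) a b
  have e : deriv (fun z => f (z - z₀)) = fun z => deriv f (z - z₀) :=
    funext fun z => deriv_comp_sub_const f z₀ z
  refine ⟨fun z => f (z - z₀), by fun_prop, fun z => ?_, by simpa using h0, by simpa [e] using h1⟩
  rw [e, deriv_comp_sub_const]
  simpa using hode (z - z₀)

/-- A solution with vanishing initial data vanishes identically. -/
lemma eq_zero_of_initial {P : Polynomial ℂ} {f : ℂ → ℂ} (hf : Differentiable ℂ f)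
    (hode : ∀ z, deriv (deriv f) z + P.eval z * f z = 0) {z₀ : ℂ} (h0 : f z₀ = 0)
    (h1 : deriv f z₀ = 0) : f = 0 := by
  funext z
  have hdf : Differentiable ℂ (deriv f) := hf.deriv
  -- Grönwall's inequality for the pair (f, f') along the segment from z₀ to z.
  set γ : ℝ → ℂ := fun t => z₀ + t * (z - z₀) with hγ
  have hγd : ∀ t, HasDerivAt γ (z - z₀) t := fun t => by
    rw [hγ]
    simpa using ((Complex.ofRealCLM.hasDerivAt (x := t)).mul_const (z - z₀)).const_add z₀
  have hγc : Continuous γ := by fun_prop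
  have hPc : Continuous fun t => ‖P.eval (γ t)‖ := (P.continuous.comp hγc).norm
  obtain ⟨B, hB⟩ := (isCompact_Icc (a := (0 : ℝ)) (b := 1)).bddAbove_image hPc.continuousOn
  set g : ℝ → ℂ × ℂ := fun t => (f (γ t), deriv f (γ t)) with hg
  set g' : ℝ → ℂ × ℂ := fun t => (deriv f (γ t) * (z - z₀), deriv (deriv f) (γ t) * (z - z₀))
  have hgd : ∀ t, HasDerivAt g (g' t) t := fun t =>
    ((hf _).hasDerivAt.comp t (hγd t)).prodMk ((hdf _).hasDerivAt.comp t (hγd t))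
  have hgc : Continuous g := continuous_iff_continuousAt.2 fun t => (hgd t).continuousAt
  have key := eq_zero_of_abs_deriv_le_mul_abs_self_of_eq_zero_right (f := g) (f' := g')
    (K := (1 + |B|) * ‖z - z₀‖) (a := 0) (b := 1) hgc.continuousOn
    (fun t _ => (hgd t).hasDerivWithinAt)
    (by simp [hg, hγ, h0, h1])
    (fun t ht => by
      have hb : ‖P.eval (γ t)‖ ≤ |B| :=
        (hB ⟨t, ⟨ht.1, ht.2.le⟩, rfl⟩).trans (le_abs_self B)
      have e : deriv (deriv f) (γ t) = -(P.eval (γ t) * f (γ t)) :=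
        eq_neg_of_add_eq_zero_left (hode _)
      have n1 : ‖f (γ t)‖ ≤ ‖g t‖ := norm_fst_le (g t)
      have n2 : ‖deriv f (γ t)‖ ≤ ‖g t‖ := norm_snd_le (g t)
      refine norm_prod_le_iff.2 ⟨?_, ?_⟩
      · simp only [g', norm_mul]
        calc ‖deriv f (γ t)‖ * ‖z - z₀‖ ≤ ((1 + |B|) * ‖g t‖) * ‖z - z₀‖ := by
              gcongr; nlinarith [abs_nonneg B, norm_nonneg (g t)]
          _ = _ := by ring
      · simp only [g', norm_mul, e, norm_neg]
        calc ‖P.eval (γ t)‖ * ‖f (γ t)‖ * ‖z - z₀‖ ≤ (|B| * ‖g t‖) * ‖z - z₀‖ := by gcongr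
          _ ≤ ((1 + |B|) * ‖g t‖) * ‖z - z₀‖ := by gcongr; linarith
          _ = _ := by ring)
    1 (by simp)
  have := congrArg Prod.fst key
  simpa [hg, hγ] using this

/-! ### The quadratic form and its monotonicity. -/

/-- The cone function `δ |u + v|² - |u - v|²`. -/
noncomputable def coneForm (δ : ℝ) (u v : ℂ) : ℝ := δ * ‖u + v‖ ^ 2 - ‖u - v‖ ^ 2

/-- The derivative of `coneForm δ u v` along `u' = κ v`, `v' = κ ((1 + e₁) u + e₂ v)`. -/
noncomputable def coneDeriv (δ : ℝ) (κ u v e₁ e₂ : ℂ) : ℝ :=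
  δ * (2 * inner ℝ (u + v) (κ * (u + v + (e₁ * u + e₂ * v)))) -
    2 * inner ℝ (u - v) (-(κ * (u - v + (e₁ * u + e₂ * v))))

/-- The combinations u + v and u - v diagonalise the unperturbed system, with rates κ and -κ. -/
lemma hasDerivAt_coneForm {u v : ℝ → ℂ} {κ e₁ e₂ : ℂ} {t : ℝ} (δ : ℝ)
    (hu : HasDerivAt u (κ * v t) t) (hv : HasDerivAt v (κ * ((1 + e₁) * u t + e₂ * v t)) t) :
    HasDerivAt (fun t => coneForm δ (u t) (v t)) (coneDeriv δ κ (u t) (v t) e₁ e₂) t := by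
  have ha : HasDerivAt (fun t => u t + v t) (κ * (u t + v t + (e₁ * u t + e₂ * v t))) t := by
    refine (hu.add hv).congr_deriv ?_; ring
  have hb : HasDerivAt (fun t => u t - v t) (-(κ * (u t - v t + (e₁ * u t + e₂ * v t)))) t := by
    refine (hu.sub hv).congr_deriv ?_; ring
  exact (ha.norm_sq.const_mul δ).sub hb.norm_sq

lemma re_mul_sq_sub_le_inner (κ a e : ℂ) :
    κ.re * ‖a‖ ^ 2 - ‖κ‖ * ‖a‖ * ‖e‖ ≤ inner ℝ a (κ * (a + e)) := by
  have h1 : inner ℝ a (κ * a) = κ.re * ‖a‖ ^ 2 := by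
    rw [Complex.inner, ← Complex.normSq_eq_norm_sq, mul_assoc, Complex.mul_conj,
      Complex.re_mul_ofReal]
  have h2 : -(‖κ‖ * ‖a‖ * ‖e‖) ≤ inner ℝ a (κ * e) := by
    have := (abs_le.1 (abs_real_inner_le_norm a (κ * e))).1
    rw [norm_mul] at this
    nlinarith
  rw [mul_add, inner_add_right, h1]
  linarith

/-- Without perturbation both terms contribute positively, at rate 2 Re κ ≥ 2c|κ|; the perturbation
costs at most half of this. The threshold η depends on δ and c only, hence is uniform in direction
and solution. -/
lemma exists_coneDeriv_lower_bound {δ c : ℝ} (hδ : 0 < δ) (hc : 0 < c) :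
    ∃ η > 0, ∀ κ u v e₁ e₂ : ℂ, ‖e₁‖ ≤ η → ‖e₂‖ ≤ η → c * ‖κ‖ ≤ κ.re →
      c * ‖κ‖ * (δ * ‖u + v‖ ^ 2 + ‖u - v‖ ^ 2) ≤ coneDeriv δ κ u v e₁ e₂ := by
  -- K comes from absorbing the mixed term (1 + δ)|a||b| into δ|a|² + |b|².
  set K : ℝ := 2 + (1 + δ) ^ 2 / δ with hK
  have hK0 : 0 < K := by positivity
  refine ⟨c / (2 * K), by positivity, fun κ u v e₁ e₂ h1 h2 hκ => ?_⟩
  set η := c / (2 * K) with hη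
  have hη0 : 0 < η := by positivity
  have hηK : 2 * η * K = c := by rw [hη]; field_simp
  set a := u + v
  set b := u - v
  set e := e₁ * u + e₂ * v
  have hA := norm_nonneg a
  have hB := norm_nonneg b
  have hk := norm_nonneg κ
  have hu : ‖u‖ ≤ (‖a‖ + ‖b‖) / 2 := by
    have : u = (a + b) / 2 := by simp only [a, b]; ring
    rw [this, norm_div, Complex.norm_two]
    gcongr; exact norm_add_le a b
  have hv : ‖v‖ ≤ (‖a‖ + ‖b‖) / 2 := by
    have : v = (a - b) / 2 := by simp only [a, b]; ring
    rw [this, norm_div, Complex.norm_two]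
    gcongr; exact norm_sub_le a b
  have he : ‖e‖ ≤ η * (‖a‖ + ‖b‖) := by
    calc ‖e‖ ≤ ‖e₁‖ * ‖u‖ + ‖e₂‖ * ‖v‖ := by
          refine (norm_add_le _ _).trans_eq ?_; rw [norm_mul, norm_mul]
      _ ≤ η * ((‖a‖ + ‖b‖) / 2) + η * ((‖a‖ + ‖b‖) / 2) := by gcongr
      _ = _ := by ring
  have i1 := re_mul_sq_sub_le_inner κ a e
  have i2 := re_mul_sq_sub_le_inner κ b e
  have key : (δ * ‖a‖ + ‖b‖) * (‖a‖ + ‖b‖) ≤ K * (δ * ‖a‖ ^ 2 + ‖b‖ ^ 2) := by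
    have h3 : 0 ≤ (δ * ‖a‖ - (1 + δ) * ‖b‖) ^ 2 / δ := by positivity
    have h4 : (δ * ‖a‖ - (1 + δ) * ‖b‖) ^ 2 / δ =
        δ * ‖a‖ ^ 2 - 2 * (1 + δ) * (‖a‖ * ‖b‖) + (1 + δ) ^ 2 / δ * ‖b‖ ^ 2 := by
      field_simp; ring
    have h5 : 0 ≤ (1 + δ) ^ 2 / δ * (δ * ‖a‖ ^ 2) := by positivity
    have h6 : 0 ≤ (1 + δ) * (‖a‖ * ‖b‖) := by positivity
    have h7 : 0 ≤ δ * ‖a‖ ^ 2 := by positivity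
    have h8 : 0 ≤ ‖b‖ ^ 2 := by positivity
    rw [hK]
    nlinarith
  have herr : (δ * ‖a‖ + ‖b‖) * ‖e‖ ≤ c / 2 * (δ * ‖a‖ ^ 2 + ‖b‖ ^ 2) := by
    calc (δ * ‖a‖ + ‖b‖) * ‖e‖ ≤ (δ * ‖a‖ + ‖b‖) * (η * (‖a‖ + ‖b‖)) := by gcongr
      _ = η * ((δ * ‖a‖ + ‖b‖) * (‖a‖ + ‖b‖)) := by ring
      _ ≤ η * (K * (δ * ‖a‖ ^ 2 + ‖b‖ ^ 2)) := by gcongr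
      _ = _ := by rw [← hηK]; ring
  have hmain : c * ‖κ‖ * (δ * ‖a‖ ^ 2 + ‖b‖ ^ 2) ≤ κ.re * (δ * ‖a‖ ^ 2 + ‖b‖ ^ 2) := by gcongr
  have herr' := mul_le_mul_of_nonneg_left herr hk
  have i1' := mul_le_mul_of_nonneg_left i1 hδ.le
  change _ ≤ δ * (2 * inner ℝ a (κ * (a + e))) - 2 * inner ℝ b (-(κ * (b + e)))
  rw [inner_neg_right]
  nlinarith

lemma weighted_norm_sq_pos {δ : ℝ} (hδ : 0 < δ) {u v : ℂ} (h : u ≠ 0 ∨ v ≠ 0) :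
    0 < δ * ‖u + v‖ ^ 2 + ‖u - v‖ ^ 2 := by
  by_contra! hle
  have h1 : 0 ≤ δ * ‖u + v‖ ^ 2 := by positivity
  have h2 : 0 ≤ ‖u - v‖ ^ 2 := by positivity
  have h3 : ‖u - v‖ ^ 2 = 0 := by linarith
  have h4 : δ * ‖u + v‖ ^ 2 = 0 := by linarith
  have h5 : u - v = 0 := by simpa using h3
  have h6 : u + v = 0 := by simpa [hδ.ne'] using h4
  have h7 : u = 0 := by linear_combination (h5 + h6) / 2
  have h8 : v = 0 := by linear_combination (h6 - h5) / 2
  tauto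

/-- `u` is eventually non-zero along the ray and `v / u` tends to `σ`. -/
def RatioTendsto (σ : ℂ) (u v : ℝ → ℂ) : Prop :=
  (∀ᶠ t in atTop, u t ≠ 0) ∧ Tendsto (fun t => v t / u t) atTop (𝓝 σ)

/-- Positivity for δ = s² says |u - v| < s|u + v|. For s ≤ 1/2 this gives |u + v| ≤ 4|u|, hence |v/u
- 1| ≤ 4s. -/
lemma RatioTendsto.of_coneForm {u v : ℝ → ℂ}
    (h : ∀ δ > 0, ∀ᶠ t in atTop, 0 < coneForm δ (u t) (v t)) : RatioTendsto 1 u v := by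
  have key : ∀ s : ℝ, 0 < s → s ≤ 1 / 2 → ∀ᶠ t in atTop, u t ≠ 0 ∧ ‖v t / u t - 1‖ ≤ 4 * s := by
    intro s hs hs2
    filter_upwards [h (s ^ 2) (by positivity)] with t ht
    have hb : ‖u t - v t‖ < s * ‖u t + v t‖ := by
      refine lt_of_pow_lt_pow_left₀ 2 (by positivity) ?_
      rw [coneForm] at ht; rw [mul_pow]; linarith
    have ha : 0 < ‖u t + v t‖ := by
      by_contra! hle
      have := norm_nonneg (u t - v t)
      nlinarith
    have hu : ‖u t + v t‖ ≤ 4 * ‖u t‖ := by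
      have h1 : ‖u t + v t‖ ≤ 2 * ‖u t‖ + ‖u t - v t‖ := by
        have : u t + v t = 2 * u t - (u t - v t) := by ring
        rw [this]
        refine (norm_sub_le _ _).trans_eq ?_
        rw [norm_mul, Complex.norm_two]
      nlinarith
    have hu0 : u t ≠ 0 := by
      rw [← norm_pos_iff]; linarith
    refine ⟨hu0, ?_⟩
    have : v t / u t - 1 = -(u t - v t) / u t := by field_simp; ring
    rw [this, norm_div, norm_neg, div_le_iff₀ (norm_pos_iff.2 hu0)]
    nlinarith
  refine ⟨(key (1 / 2) (by norm_num) le_rfl).mono fun t ht => ht.1, ?_⟩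
  rw [Metric.tendsto_nhds]
  intro ε hε
  filter_upwards [key (min (1 / 2) (ε / 8)) (by positivity) (min_le_left _ _)] with t ht
  rw [dist_eq_norm]
  have := min_le_right (1 / 2) (ε / 8)
  linarith [ht.2]

/-- Changing the sign of v exchanges the roles of growth and decay, at the price of inverting δ. -/
lemma coneForm_neg {δ : ℝ} (hδ : δ ≠ 0) (u v : ℂ) :
    coneForm δ u (-v) = -δ * coneForm δ⁻¹ u v := by
  rw [coneForm, coneForm, ← sub_eq_add_neg, sub_neg_eq_add]
  field_simp; ring

lemma coneForm_one_eq {u : ℂ} (hu : u ≠ 0) (v : ℂ) :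
    coneForm 1 u v = 4 * ‖u‖ ^ 2 * (v / u).re := by
  obtain ⟨w, rfl⟩ : ∃ w, v = w * u := ⟨v / u, by field_simp⟩
  rw [mul_div_cancel_right₀ _ hu, coneForm]
  have h1 : u + w * u = (1 + w) * u := by ring
  have h2 : u - w * u = (1 - w) * u := by ring
  rw [h1, h2, norm_mul, norm_mul, mul_pow, mul_pow, ← Complex.normSq_eq_norm_sq (1 + w),
    ← Complex.normSq_eq_norm_sq (1 - w), Complex.normSq_apply, Complex.normSq_apply]
  simp only [Complex.add_re, Complex.sub_re, Complex.add_im, Complex.sub_im, Complex.one_re,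
    Complex.one_im]
  ring

lemma RatioTendsto.eventually_coneForm_pos {u v : ℝ → ℂ} (h : RatioTendsto 1 u v) :
    ∀ᶠ t in atTop, 0 < coneForm 1 (u t) (v t) := by
  have h2 : Tendsto (fun t => (v t / u t).re) atTop (𝓝 1) :=
    (Complex.continuous_re.tendsto 1).comp h.2
  filter_upwards [h.1, h2.eventually (lt_mem_nhds (zero_lt_one' ℝ))] with t ht ht2
  rw [coneForm_one_eq ht]
  have := norm_pos_iff.2 ht
  positivity

lemma RatioTendsto.eventually_coneForm_neg {u v : ℝ → ℂ} (h : RatioTendsto (-1) u v) :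
    ∀ᶠ t in atTop, coneForm 1 (u t) (v t) < 0 := by
  have h2 : Tendsto (fun t => (v t / u t).re) atTop (𝓝 (-1)) := by
    have := (Complex.continuous_re.tendsto (-1)).comp h.2
    rwa [Complex.neg_re, Complex.one_re] at this
  filter_upwards [h.1, h2.eventually (gt_mem_nhds (by norm_num : (-1 : ℝ) < 0))] with t ht ht2
  rw [coneForm_one_eq ht]
  have := norm_pos_iff.2 ht
  exact mul_neg_of_pos_of_neg (by positivity) ht2

/-! ### The dichotomy along a single ray. -/

/-- A perturbed system `u' = κ v`, `v' = κ ((1 + e₁) u + e₂ v)` near infinity. -/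
structure RaySystem (κ : ℂ) (u v : ℝ → ℂ) : Prop where
  exists_perturbation : ∃ e₁ e₂ : ℝ → ℂ, Tendsto e₁ atTop (𝓝 0) ∧ Tendsto e₂ atTop (𝓝 0) ∧
    ∀ᶠ t in atTop, HasDerivAt v (κ * ((1 + e₁ t) * u t + e₂ t * v t)) t
  deriv_fst : ∀ᶠ t in atTop, HasDerivAt u (κ * v t) t
  ne_zero : ∀ᶠ t in atTop, u t ≠ 0 ∨ v t ≠ 0

/-- This reduces Re κ < 0 to Re κ > 0, with the limits 1 and -1 of v/u interchanged. -/
lemma RaySystem.neg {κ : ℂ} {u v : ℝ → ℂ} (h : RaySystem κ u v) :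
    RaySystem (-κ) u (fun t => -v t) := by
  obtain ⟨⟨e₁, e₂, h1, h2, h3⟩, hu, h0⟩ := h
  refine ⟨⟨e₁, fun t => -e₂ t, h1, by simpa using h2.neg, ?_⟩, ?_, ?_⟩
  · filter_upwards [h3] with t ht
    refine ht.neg.congr_deriv ?_; ring
  · filter_upwards [hu] with t ht
    refine ht.congr_deriv ?_; ring
  · simpa using h0

/-- The last bound is quantitative because mere monotonicity cannot force a negative form to become
positive. -/
lemma RaySystem.exists_hasDerivAt_coneForm {κ : ℂ} {u v : ℝ → ℂ} (h : RaySystem κ u v)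
    (hκ : 0 < κ.re) {δ : ℝ} (hδ : 0 < δ) :
    ∃ D : ℝ → ℝ, ∀ᶠ t in atTop, HasDerivAt (fun t => coneForm δ (u t) (v t)) (D t) t ∧ 0 < D t ∧
      κ.re * (δ * ‖u t + v t‖ ^ 2) ≤ D t := by
  obtain ⟨⟨e₁, e₂, h1, h2, h3⟩, hu, h0⟩ := h
  have hκn : 0 < ‖κ‖ := hκ.trans_le (Complex.re_le_norm κ)
  obtain ⟨η, hη, hb⟩ := exists_coneDeriv_lower_bound hδ (c := κ.re / ‖κ‖) (by positivity)
  have hcκ : κ.re / ‖κ‖ * ‖κ‖ = κ.re := by field_simp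
  have small : ∀ {e : ℝ → ℂ}, Tendsto e atTop (𝓝 0) → ∀ᶠ t in atTop, ‖e t‖ ≤ η := fun he => by
    have := he.norm
    rw [norm_zero] at this
    exact this.eventually (ge_mem_nhds hη)
  refine ⟨fun t => coneDeriv δ κ (u t) (v t) (e₁ t) (e₂ t), ?_⟩
  filter_upwards [h3, hu, h0, small h1, small h2] with t ht3 htu ht0 hs1 hs2
  have hlow := hb κ (u t) (v t) _ _ hs1 hs2 hcκ.le
  rw [hcκ] at hlow
  have hpos := weighted_norm_sq_pos hδ ht0
  refine ⟨hasDerivAt_coneForm δ htu ht3, lt_of_lt_of_le (by positivity) hlow,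
    le_trans ?_ hlow⟩
  gcongr
  have : 0 ≤ ‖u t - v t‖ ^ 2 := by positivity
  linarith

lemma RaySystem.exists_strictMonoOn_coneForm {κ : ℂ} {u v : ℝ → ℂ} (h : RaySystem κ u v)
    (hκ : 0 < κ.re) {δ : ℝ} (hδ : 0 < δ) :
    ∃ T : ℝ, StrictMonoOn (fun t => coneForm δ (u t) (v t)) (Set.Ici T) := by
  obtain ⟨D, hD⟩ := h.exists_hasDerivAt_coneForm hκ hδ
  obtain ⟨T, hT⟩ := eventually_atTop.1 hD
  refine ⟨T, strictMonoOn_of_deriv_pos (convex_Ici T)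
    (fun t ht => (hT t ht).1.continuousAt.continuousWithinAt) fun t ht => ?_⟩
  rw [interior_Ici] at ht
  rw [(hT t (Set.mem_Ioi.1 ht).le).1.deriv]
  exact (hT t (Set.mem_Ioi.1 ht).le).2.1

lemma eventually_neg_or_pos_of_strictMonoOn {N : ℝ → ℝ} {T : ℝ}
    (h : StrictMonoOn N (Set.Ici T)) :
    (∀ᶠ t in atTop, N t < 0) ∨ ∃ m > 0, ∀ᶠ t in atTop, m ≤ N t := by
  by_cases hex : ∃ t ≥ T, 0 ≤ N t
  · obtain ⟨t, ht, h0⟩ := hex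
    have h1 : N t < N (t + 1) := h ht (by simp only [Set.mem_Ici]; linarith) (by linarith)
    refine Or.inr ⟨N (t + 1), h0.trans_lt h1, ?_⟩
    filter_upwards [eventually_ge_atTop (t + 1)] with s hs
    exact h.monotoneOn (by simp only [Set.mem_Ici]; linarith)
      (by simp only [Set.mem_Ici]; linarith) hs
  · push Not at hex
    exact Or.inl (by filter_upwards [eventually_ge_atTop T] with s hs using hex s hs)

/-- The ray dichotomy for `Re κ > 0`. -/
lemma RaySystem.ratioTendsto_of_re_pos {κ : ℂ} {u v : ℝ → ℂ} (h : RaySystem κ u v)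
    (hκ : 0 < κ.re) : RatioTendsto 1 u v ∨ RatioTendsto (-1) u v := by
  have tri : ∀ δ > 0, (∀ᶠ t in atTop, coneForm δ (u t) (v t) < 0) ∨
      ∃ m > 0, ∀ᶠ t in atTop, m ≤ coneForm δ (u t) (v t) := fun δ hδ => by
    obtain ⟨T, hT⟩ := h.exists_strictMonoOn_coneForm hκ hδ
    exact eventually_neg_or_pos_of_strictMonoOn hT
  by_cases hneg : ∀ δ > 0, ∀ᶠ t in atTop, coneForm δ (u t) (v t) < 0
  · right
    have h1 : RatioTendsto 1 u (fun t => -v t) := by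
      refine RatioTendsto.of_coneForm fun δ hδ => ?_
      filter_upwards [hneg δ⁻¹ (by positivity)] with t ht
      rw [coneForm_neg hδ.ne']
      nlinarith
    refine ⟨h1.1, ?_⟩
    have := h1.2.neg
    simpa [neg_div] using this
  · left
    push Not at hneg
    obtain ⟨δ₂, hδ₂, hn⟩ := hneg
    obtain ⟨m, hm, hev⟩ := (tri δ₂ hδ₂).resolve_left fun h' => hn (h'.mono fun t ht => by simpa using ht)
    refine RatioTendsto.of_coneForm fun δ₁ hδ₁ => ?_
    rcases tri δ₁ hδ₁ with hlt | ⟨m', hm', hpos⟩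
    · exfalso
      obtain ⟨D, hD⟩ := h.exists_hasDerivAt_coneForm hκ hδ₁
      obtain ⟨T, hT⟩ := eventually_atTop.1 (hlt.and (hev.and hD))
      -- The bound m for the form with δ₂ gives |u + v|² ≥ m/δ₂, so the form with δ₁ grows at least
      -- at rate k and cannot stay negative.
      set k : ℝ := κ.re * (δ₁ * (m / δ₂))
      have hk : 0 < k := by positivity
      have hmono : MonotoneOn (fun t => coneForm δ₁ (u t) (v t) - k * t) (Set.Ici T) := by
        have hd : ∀ t ≥ T, HasDerivAt (fun t => coneForm δ₁ (u t) (v t) - k * t) (D t - k) t :=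
          fun t ht =>
            ((hT t ht).2.2.1.sub ((hasDerivAt_id t).const_mul k)).congr_deriv (by rw [mul_one])
        refine monotoneOn_of_deriv_nonneg (convex_Ici T)
          (fun t ht => (hd t ht).continuousAt.continuousWithinAt)
          (fun t ht => (hd t (interior_subset ht)).differentiableAt.differentiableWithinAt)
          fun t ht => ?_
        have ht' : T ≤ t := interior_subset ht
        rw [(hd t ht').deriv, sub_nonneg]
        refine le_trans ?_ (hT t ht').2.2.2.2
        have hm2 := (hT t ht').2.1
        have : m / δ₂ ≤ ‖u t + v t‖ ^ 2 := by
          rw [div_le_iff₀ hδ₂]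
          rw [coneForm] at hm2
          have : 0 ≤ ‖u t - v t‖ ^ 2 := by positivity
          linarith
        exact mul_le_mul_of_nonneg_left (mul_le_mul_of_nonneg_left this hδ₁.le) hκ.le
      -- The time at which growth at rate k from T must have brought the form up to 0.
      have hge : T ≤ T + (-coneForm δ₁ (u T) (v T)) / k := by
        have : 0 ≤ (-coneForm δ₁ (u T) (v T)) / k := by
          have := (hT T le_rfl).1
          apply div_nonneg <;> linarith
        linarith
      have h1 := hmono (Set.mem_Ici.2 le_rfl) (Set.mem_Ici.2 hge) hge
      have h2 := (hT _ hge).1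
      have h3 : k * (T + (-coneForm δ₁ (u T) (v T)) / k) = k * T - coneForm δ₁ (u T) (v T) := by
        field_simp; ring
      simp only [h3] at h1
      linarith
    · exact hpos.mono fun t ht => hm'.trans_le ht

/-- The ray dichotomy. -/
lemma RaySystem.ratioTendsto {κ : ℂ} {u v : ℝ → ℂ} (h : RaySystem κ u v) (hκ : κ.re ≠ 0) :
    RatioTendsto 1 u v ∨ RatioTendsto (-1) u v := by
  rcases lt_or_gt_of_ne hκ with hlt | hgt
  · rcases h.neg.ratioTendsto_of_re_pos (by simpa using hlt) with h1 | h1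
    · exact Or.inr ⟨h1.1, by simpa [neg_div] using h1.2.neg⟩
    · exact Or.inl ⟨h1.1, by simpa [neg_div] using h1.2.neg⟩
  · exact h.ratioTendsto_of_re_pos hgt

/-! ### Exponential form from the limit of the logarithmic derivative. -/

/-- A function whose derivative tends to `c` grows like `c t`. -/
lemma tendsto_div_of_tendsto_deriv {g g' : ℝ → ℂ} {c : ℂ}
    (hg : ∀ᶠ t in atTop, HasDerivAt g (g' t) t) (hc : Tendsto g' atTop (𝓝 c)) :
    Tendsto (fun t : ℝ => g t / t) atTop (𝓝 c) := by
  rw [Metric.tendsto_nhds]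
  intro ε hε
  have hc' : ∀ᶠ t in atTop, ‖g' t - c‖ ≤ ε / 4 := by
    filter_upwards [Metric.tendsto_nhds.1 hc (ε / 4) (by positivity)] with t ht
    rw [← dist_eq_norm]; exact ht.le
  obtain ⟨T, hT⟩ := eventually_atTop.1 (hg.and hc')
  set B := ‖g T - c * T‖ with hB
  filter_upwards [eventually_ge_atTop T, eventually_gt_atTop 0,
    eventually_ge_atTop (4 * B / ε), eventually_ge_atTop (-T)] with t ht ht0 htB htT
  have hd : ∀ s ∈ Set.Ici T, HasDerivWithinAt (fun s : ℝ => g s - c * s) (g' s - c) (Set.Ici T) s :=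
    fun s hs => by
      have := (hT s hs).1.sub ((Complex.ofRealCLM.hasDerivAt (x := s)).const_mul c)
      exact this.hasDerivWithinAt.congr_deriv (by simp)
  have h1 := (convex_Ici T).norm_image_sub_le_of_norm_hasDerivWithin_le hd
    (fun s hs => (hT s hs).2) (Set.mem_Ici.2 le_rfl) (Set.mem_Ici.2 ht)
  have h2 : ‖g t - c * t‖ ≤ B + ε / 4 * (t - T) := by
    rw [Real.norm_of_nonneg (sub_nonneg.2 ht)] at h1
    have := norm_le_norm_add_norm_sub' (g t - c * t) (g T - c * T)
    linarith
  have htc : (t : ℂ) ≠ 0 := by exact_mod_cast ht0.ne'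
  have h3 : g t / t - c = (g t - c * t) / t := by field_simp
  rw [dist_eq_norm, h3, norm_div, Complex.norm_real, Real.norm_of_nonneg ht0.le,
    div_lt_iff₀ ht0]
  rw [div_le_iff₀ hε] at htB
  nlinarith

/-- The logarithmic derivative κ v/u tends to κσ. Its primitive is a logarithm of u without any
choice of branch, and is asymptotic to κσt. -/
lemma RaySystem.exists_exp_form {κ σ : ℂ} {u v : ℝ → ℂ} (h : RaySystem κ u v) (hκ : κ ≠ 0)
    (hσ : σ ≠ 0) (hr : RatioTendsto σ u v) :
    ∃ ε : ℝ → ℂ, Tendsto ε atTop (𝓝 0) ∧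
      ∀ᶠ t in atTop, u t = Complex.exp (σ * κ * t * (1 + ε t)) := by
  obtain ⟨⟨e₁, e₂, -, -, h3⟩, hu, -⟩ := h
  obtain ⟨T, hT⟩ := eventually_atTop.1 (hu.and (h3.and hr.1))
  set g' : ℝ → ℂ := fun t => κ * (v t / u t)
  have hcont : ∀ t ≥ T, ContinuousAt g' t := fun t ht =>
    ((hT t ht).2.1.continuousAt.div (hT t ht).1.continuousAt (hT t ht).2.2).const_mul κ
  have hcs : ContinuousOn g' (Set.Ici T) := fun t ht => (hcont t ht).continuousWithinAt
  set g : ℝ → ℂ := fun t => Complex.log (u T) + ∫ s in T..t, g' s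
  have hg : ∀ t > T, HasDerivAt g (g' t) t := fun t ht => by
    refine (intervalIntegral.integral_hasDerivAt_right ?_ ?_ (hcont t ht.le)).const_add _
    · exact (hcs.mono (by rw [Set.uIcc_of_le ht.le]; exact Set.Icc_subset_Ici_self)).intervalIntegrable
    · exact (hcs.mono Set.Ioi_subset_Ici_self).stronglyMeasurableAtFilter isOpen_Ioi t ht
  have hgc : ContinuousOn g (Set.Ici T) := by
    intro t ht
    have hsub : Set.uIcc T (t + 1) ⊆ Set.Ici T := by
      rw [Set.uIcc_of_le (by linarith [Set.mem_Ici.1 ht])]; exact Set.Icc_subset_Ici_self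
    have h1 := intervalIntegral.continuousOn_primitive_interval
      ((hcs.mono hsub).integrableOn_uIcc (μ := MeasureTheory.volume))
    have h2 : ContinuousWithinAt g (Set.uIcc T (t + 1)) t :=
      (h1 t (by
        rw [Set.uIcc_of_le (by linarith [Set.mem_Ici.1 ht])]
        exact ⟨ht, by linarith⟩)).const_add _
    refine h2.mono_of_mem_nhdsWithin ?_
    rw [Set.uIcc_of_le (by linarith [Set.mem_Ici.1 ht]), ← Set.Ici_inter_Iic]
    exact Filter.inter_mem self_mem_nhdsWithin
      (mem_nhdsWithin_of_mem_nhds (Iic_mem_nhds (by linarith)))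
  have hexp : ∀ t ≥ T, u t = Complex.exp (g t) := by
    intro t ht
    have hc : ContinuousOn (fun t => u t * Complex.exp (-g t)) (Set.Icc T t) := by
      refine ContinuousOn.mul (fun s hs => (hT s hs.1).1.continuousAt.continuousWithinAt) ?_
      exact (hgc.mono Set.Icc_subset_Ici_self).neg.cexp
    have heq : u t * Complex.exp (-g t) = u T * Complex.exp (-g T) := by
      refine constant_of_has_deriv_right_zero hc (fun s hs => ?_) t ⟨ht, le_rfl⟩
      rcases eq_or_lt_of_le hs.1 with rfl | hlt
      -- At the endpoint T the primitive is differentiated from the right only.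
      · have h1 : HasDerivWithinAt g (g' T) (Set.Ici T) T := by
          refine (intervalIntegral.integral_hasDerivWithinAt_right (by simp)
            (s := Set.Ici T) (t := Set.Ioi T) ?_ (hcont T le_rfl).continuousWithinAt).const_add _
          exact ContinuousOn.stronglyMeasurableAtFilter_nhdsWithin
            (hcs.mono Set.Ioi_subset_Ici_self) measurableSet_Ioi T
        have := (hT T le_rfl).1.hasDerivWithinAt.mul h1.neg.cexp
        refine this.congr_deriv ?_
        have := (hT T le_rfl).2.2
        simp only [g']; field_simp; ring
      · have := ((hT s hs.1).1.mul (hg s hlt).neg.cexp).hasDerivWithinAt (s := Set.Ici s)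
        refine this.congr_deriv ?_
        have := (hT s hs.1).2.2
        simp only [g']; field_simp; ring
    have hgT : u T * Complex.exp (-g T) = 1 := by
      have h0 := (hT T le_rfl).2.2
      simp only [g, intervalIntegral.integral_same, add_zero, Complex.exp_neg,
        Complex.exp_log h0]
      exact mul_inv_cancel₀ h0
    rw [hgT, Complex.exp_neg] at heq
    exact (mul_inv_eq_one₀ (Complex.exp_ne_zero _)).1 heq
  have hlim : Tendsto g' atTop (𝓝 (κ * σ)) := hr.2.const_mul κ
  have hdiv := tendsto_div_of_tendsto_deriv (g := g) (g' := g')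
    (by filter_upwards [eventually_gt_atTop T] with t ht using hg t ht) hlim
  refine ⟨fun t => g t / t / (κ * σ) - 1, ?_, ?_⟩
  · have := (hdiv.div_const (κ * σ)).sub_const 1
    rwa [div_self (mul_ne_zero hκ hσ), sub_self] at this
  · filter_upwards [eventually_ge_atTop T, eventually_gt_atTop 0] with t ht ht0
    have htc : (t : ℂ) ≠ 0 := by exact_mod_cast ht0.ne'
    rw [hexp t ht]
    congr 1
    field_simp
    ring

/-! ### The perturbed system in the slit plane. -/

lemma polarPoint_re (θ r : ℝ) : (polarPoint θ r).re = r * Real.cos θ := by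
  rw [polarPoint, Complex.re_ofReal_mul, Complex.exp_ofReal_mul_I_re]

lemma polarPoint_im (θ r : ℝ) : (polarPoint θ r).im = r * Real.sin θ := by
  rw [polarPoint, Complex.im_ofReal_mul, Complex.exp_ofReal_mul_I_im]

lemma norm_polarPoint {θ r : ℝ} (hr : 0 ≤ r) : ‖polarPoint θ r‖ = r := by
  rw [polarPoint, norm_mul, Complex.norm_exp_ofReal_mul_I, mul_one, Complex.norm_real,
    Real.norm_of_nonneg hr]

lemma arg_polarPoint {θ r : ℝ} (hr : 0 < r) (hθ : θ ∈ Set.Ioo (-Real.pi) Real.pi) :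
    (polarPoint θ r).arg = θ := by
  rw [polarPoint, Complex.exp_mul_I, Complex.arg_mul_cos_add_sin_mul_I hr ⟨hθ.1, hθ.2.le⟩]

lemma polarPoint_mem_slitPlane {θ r : ℝ} (hr : 0 < r) (hθ : θ ∈ Set.Ioo (-Real.pi) Real.pi) :
    polarPoint θ r ∈ Complex.slitPlane := by
  rw [Complex.mem_slitPlane_iff_arg, arg_polarPoint hr hθ]
  refine ⟨hθ.2.ne, fun h => ?_⟩
  have := norm_polarPoint (θ := θ) hr.le
  rw [h, norm_zero] at this
  exact hr.ne this

/-- `E` tends to `0` at infinity in the slit plane. -/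
def SmallAtInfinity (E : ℂ → ℂ) : Prop :=
  ∀ η > 0, ∃ R : ℝ, ∀ w ∈ Complex.slitPlane, R ≤ ‖w‖ → ‖E w‖ ≤ η

/-- A non-trivial solution of `F' = V`, `V' = (1 + E₁) F + E₂ V` in the slit plane. -/
structure PlaneSystem (E₁ E₂ F V : ℂ → ℂ) : Prop where
  deriv_fst : ∀ w ∈ Complex.slitPlane, HasDerivAt F (V w) w
  deriv_snd : ∀ w ∈ Complex.slitPlane, HasDerivAt V ((1 + E₁ w) * F w + E₂ w * V w) w
  ne_zero : ∀ w ∈ Complex.slitPlane, F w ≠ 0 ∨ V w ≠ 0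

lemma SmallAtInfinity.tendsto {E : ℂ → ℂ} (h : SmallAtInfinity E) {φ : ℝ}
    (hφ : φ ∈ Set.Ioo (-Real.pi) Real.pi) :
    Tendsto (fun t => E (polarPoint φ t)) atTop (𝓝 0) := by
  rw [Metric.tendsto_nhds]
  intro ε hε
  obtain ⟨R, hR⟩ := h (ε / 2) (by positivity)
  filter_upwards [eventually_gt_atTop 0, eventually_ge_atTop R] with t ht htR
  rw [dist_zero_right]
  have := hR _ (polarPoint_mem_slitPlane ht hφ) (by rwa [norm_polarPoint ht.le])
  linarith

section

variable {E₁ E₂ F V : ℂ → ℂ}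

lemma PlaneSystem.raySystem (h : PlaneSystem E₁ E₂ F V) (h₁ : SmallAtInfinity E₁)
    (h₂ : SmallAtInfinity E₂) {φ : ℝ} (hφ : φ ∈ Set.Ioo (-Real.pi) Real.pi) :
    RaySystem (Complex.exp (φ * Complex.I)) (fun t => F (polarPoint φ t))
      (fun t => V (polarPoint φ t)) := by
  have hp : ∀ t : ℝ, HasDerivAt (polarPoint φ) (Complex.exp (φ * Complex.I)) t := fun t =>
    ((Complex.ofRealCLM.hasDerivAt (x := t)).mul_const _).congr_deriv (by simp)
  refine ⟨⟨_, _, h₁.tendsto hφ, h₂.tendsto hφ, ?_⟩, ?_, ?_⟩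
  · filter_upwards [eventually_gt_atTop 0] with t ht
    refine ((h.deriv_snd _ (polarPoint_mem_slitPlane ht hφ)).comp t (hp t)).congr_deriv ?_
    ring
  · filter_upwards [eventually_gt_atTop 0] with t ht
    refine ((h.deriv_fst _ (polarPoint_mem_slitPlane ht hφ)).comp t (hp t)).congr_deriv ?_
    ring
  · filter_upwards [eventually_gt_atTop 0] with t ht
    exact h.ne_zero _ (polarPoint_mem_slitPlane ht hφ)

/-- Moving along a segment is a system with κ = w' - w, so different rays can be compared. R does
not depend on the solution, which matters when solutions vary in a sequence. -/
lemma exists_coneForm_lt_of_segment (h₁ : SmallAtInfinity E₁) (h₂ : SmallAtInfinity E₂) {c : ℝ}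
    (hc : 0 < c) :
    ∃ R : ℝ, ∀ F V : ℂ → ℂ, PlaneSystem E₁ E₂ F V → ∀ w w' : ℂ, w ≠ w' →
      c * ‖w' - w‖ ≤ (w' - w).re →
      (∀ τ ∈ Set.Icc (0 : ℝ) 1, w + τ * (w' - w) ∈ Complex.slitPlane ∧
        R ≤ ‖w + τ * (w' - w)‖) →
      coneForm 1 (F w) (V w) < coneForm 1 (F w') (V w') := by
  obtain ⟨η, hη, hb⟩ := exists_coneDeriv_lower_bound one_pos hc
  obtain ⟨R₁, hR₁⟩ := h₁ η hη
  obtain ⟨R₂, hR₂⟩ := h₂ η hη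
  refine ⟨max R₁ R₂, fun F V h w w' hne hκ hseg => ?_⟩
  set γ : ℝ → ℂ := fun τ => w + τ * (w' - w) with hγ
  have hp : ∀ τ : ℝ, HasDerivAt γ (w' - w) τ := fun τ =>
    (((Complex.ofRealCLM.hasDerivAt (x := τ)).mul_const (w' - w)).const_add w).congr_deriv (by simp)
  have hd : ∀ τ ∈ Set.Icc (0 : ℝ) 1, HasDerivAt (fun τ => coneForm 1 (F (γ τ)) (V (γ τ)))
      (coneDeriv 1 (w' - w) (F (γ τ)) (V (γ τ)) (E₁ (γ τ)) (E₂ (γ τ))) τ := fun τ hτ =>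
    hasDerivAt_coneForm 1
      (((h.deriv_fst _ (hseg τ hτ).1).comp τ (hp τ)).congr_deriv (mul_comm _ _))
      (((h.deriv_snd _ (hseg τ hτ).1).comp τ (hp τ)).congr_deriv (mul_comm _ _))
  have hmono : StrictMonoOn (fun τ => coneForm 1 (F (γ τ)) (V (γ τ))) (Set.Icc (0 : ℝ) 1) := by
    refine strictMonoOn_of_deriv_pos (convex_Icc 0 1)
      (fun τ hτ => (hd τ hτ).continuousAt.continuousWithinAt) fun τ hτ => ?_
    have hτ' := interior_subset hτ
    obtain ⟨hs, hR⟩ := hseg τ hτ'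
    rw [(hd τ hτ').deriv]
    refine lt_of_lt_of_le ?_ (hb _ _ _ _ _ (hR₁ _ hs ((le_max_left _ _).trans hR))
      (hR₂ _ hs ((le_max_right _ _).trans hR)) hκ)
    have := weighted_norm_sq_pos one_pos (h.ne_zero _ hs)
    have := norm_pos_iff.2 (sub_ne_zero.2 hne.symm)
    positivity
  have := hmono (Set.left_mem_Icc.2 zero_le_one) (Set.right_mem_Icc.2 zero_le_one) one_pos
  simpa [hγ] using this

lemma cos_pos_and_mem_Ioo {φ : ℝ} (hφ : φ ∈ Set.Ioo (-(Real.pi / 2)) (Real.pi / 2)) :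
    0 < Real.cos φ ∧ φ ∈ Set.Ioo (-Real.pi) Real.pi :=
  ⟨Real.cos_pos_of_mem_Ioo hφ, by linarith [hφ.1, Real.pi_pos], by linarith [hφ.2, Real.pi_pos]⟩

lemma PlaneSystem.ratioTendsto (h : PlaneSystem E₁ E₂ F V) (h₁ : SmallAtInfinity E₁)
    (h₂ : SmallAtInfinity E₂) {φ : ℝ} (hφ : φ ∈ Set.Ioo (-Real.pi) Real.pi)
    (hcos : Real.cos φ ≠ 0) :
    RatioTendsto 1 (fun t => F (polarPoint φ t)) (fun t => V (polarPoint φ t)) ∨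
      RatioTendsto (-1) (fun t => F (polarPoint φ t)) (fun t => V (polarPoint φ t)) :=
  (h.raySystem h₁ h₂ hφ).ratioTendsto (by rwa [Complex.exp_ofReal_mul_I_re])

/-- Decay on one ray of the right half-plane implies decay on all of them. -/
lemma PlaneSystem.ratioTendsto_neg_one (h : PlaneSystem E₁ E₂ F V) (h₁ : SmallAtInfinity E₁)
    (h₂ : SmallAtInfinity E₂) {φ₀ φ : ℝ} (hφ₀ : φ₀ ∈ Set.Ioo (-(Real.pi / 2)) (Real.pi / 2))
    (hφ : φ ∈ Set.Ioo (-(Real.pi / 2)) (Real.pi / 2))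
    (hdec : RatioTendsto (-1) (fun t => F (polarPoint φ₀ t)) (fun t => V (polarPoint φ₀ t))) :
    RatioTendsto (-1) (fun t => F (polarPoint φ t)) (fun t => V (polarPoint φ t)) := by
  obtain ⟨hcos₀, hφ₀'⟩ := cos_pos_and_mem_Ioo hφ₀
  obtain ⟨hcos, hφ'⟩ := cos_pos_and_mem_Ioo hφ
  refine (h.ratioTendsto h₁ h₂ hφ' hcos.ne').resolve_left fun hgrow => ?_
  -- As T → ∞ the direction from a fixed point to the point T on the ray φ₀ tends to φ₀, so half of
  -- cos φ₀ is a safe bound for its cosine.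
  set c : ℝ := Real.cos φ₀ / 2 with hc
  obtain ⟨R, hR⟩ := exists_coneForm_lt_of_segment h₁ h₂ (c := c) (by positivity)
  obtain ⟨s, hs, hs0, hsR⟩ := (hgrow.eventually_coneForm_pos.and
    ((eventually_gt_atTop 0).and (eventually_ge_atTop (R / Real.cos φ)))).exists
  -- The first lower bound on T keeps the segment at real part at least s cos φ ≥ R; the second
  -- gives the direction condition.
  obtain ⟨T, hT, hT0, hTs, hTs'⟩ := (hdec.eventually_coneForm_neg.and
    ((eventually_gt_atTop 0).and ((eventually_ge_atTop (s * Real.cos φ / Real.cos φ₀)).and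
      (eventually_ge_atTop (s * (Real.cos φ + c) / c))))).exists
  rw [div_le_iff₀ hcos] at hsR
  rw [div_le_iff₀ hcos₀] at hTs
  rw [div_le_iff₀ (by positivity)] at hTs'
  have hlt := hR F V h (polarPoint φ s) (polarPoint φ₀ T)
    (fun heq => by rw [heq] at hs; linarith)
    (by
      have h1 : ‖polarPoint φ₀ T - polarPoint φ s‖ ≤ T + s :=
        (norm_sub_le _ _).trans_eq (by rw [norm_polarPoint hT0.le, norm_polarPoint hs0.le])
      have h2 : c * ‖polarPoint φ₀ T - polarPoint φ s‖ ≤ c * (T + s) := by gcongr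
      rw [Complex.sub_re, polarPoint_re, polarPoint_re]
      have h3 : Real.cos φ₀ = 2 * c := by rw [hc]; ring
      rw [h3]
      nlinarith)
    (fun τ hτ => by
      have hre : s * Real.cos φ ≤
          (polarPoint φ s + τ * (polarPoint φ₀ T - polarPoint φ s)).re := by
        rw [Complex.add_re, Complex.re_ofReal_mul, Complex.sub_re, polarPoint_re, polarPoint_re]
        have := mul_nonneg hτ.1 (sub_nonneg.2 hTs)
        linarith
      exact ⟨Or.inl ((mul_pos hs0 hcos).trans_le hre),
        hsR.trans (hre.trans (Complex.re_le_norm _))⟩)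
  linarith

/-- No solution decays on both sides of the positive imaginary axis. -/
lemma PlaneSystem.not_decay_both_sides (h : PlaneSystem E₁ E₂ F V) (h₁ : SmallAtInfinity E₁)
    (h₂ : SmallAtInfinity E₂)
    (hl : RatioTendsto 1 (fun t => F (polarPoint (Real.pi - Real.pi / 4) t))
      (fun t => V (polarPoint (Real.pi - Real.pi / 4) t)))
    (hr : RatioTendsto (-1) (fun t => F (polarPoint (Real.pi / 4) t))
      (fun t => V (polarPoint (Real.pi / 4) t))) : False := by
  -- On the left ray Re w < 0, so decay there means F'/F → 1 and the form is positive; on the right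
  -- ray it is negative.
  obtain ⟨R, hR⟩ := exists_coneForm_lt_of_segment h₁ h₂ (c := 1) one_pos
  have hsin : 0 < Real.sin (Real.pi / 4) :=
    Real.sin_pos_of_pos_of_lt_pi (by positivity) (by linarith [Real.pi_pos])
  have hcos : 0 < Real.cos (Real.pi / 4) :=
    Real.cos_pos_of_mem_Ioo ⟨by linarith [Real.pi_pos], by linarith [Real.pi_pos]⟩
  obtain ⟨t, htl, htr, ht0, htR⟩ := (hl.eventually_coneForm_pos.and
    (hr.eventually_coneForm_neg.and
    ((eventually_gt_atTop 0).and (eventually_ge_atTop (R / Real.sin (Real.pi / 4)))))).exists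
  rw [div_le_iff₀ hsin] at htR
  -- The two points have the same height, so the segment is horizontal and stays off the slit at
  -- height t sin(π/4) ≥ R.
  have e : polarPoint (Real.pi / 4) t - polarPoint (Real.pi - Real.pi / 4) t =
      ((2 * t * Real.cos (Real.pi / 4) : ℝ) : ℂ) := by
    apply Complex.ext
    · rw [Complex.sub_re, polarPoint_re, polarPoint_re, Real.cos_pi_sub, Complex.ofReal_re]; ring
    · rw [Complex.sub_im, polarPoint_im, polarPoint_im, Real.sin_pi_sub, Complex.ofReal_im]; ring
  have hlt := hR F V h (polarPoint (Real.pi - Real.pi / 4) t) (polarPoint (Real.pi / 4) t)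
    (fun heq => by rw [heq] at htl; linarith)
    (by rw [e, Complex.norm_real, Complex.ofReal_re, Real.norm_of_nonneg (by positivity), one_mul])
    (fun τ hτ => by
      have him : (polarPoint (Real.pi - Real.pi / 4) t + τ * (polarPoint (Real.pi / 4) t -
          polarPoint (Real.pi - Real.pi / 4) t)).im = t * Real.sin (Real.pi / 4) := by
        rw [e, ← Complex.ofReal_mul, Complex.add_im, Complex.ofReal_im, polarPoint_im,
          Real.sin_pi_sub, add_zero]
      have hpos : 0 < t * Real.sin (Real.pi / 4) := by positivity
      refine ⟨Or.inr ?_, ?_⟩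
      · rw [him]; exact hpos.ne'
      · refine htR.trans (le_trans ?_ (Complex.abs_im_le_norm _))
        rw [him]; exact le_abs_self _)
  linarith

/-! ### Growing and decaying solutions on the positive axis. -/

lemma polarPoint_zero (t : ℝ) : polarPoint 0 t = t := by simp [polarPoint]

lemma zero_mem_right_angles : (0 : ℝ) ∈ Set.Ioo (-(Real.pi / 2)) (Real.pi / 2) :=
  ⟨by linarith [Real.pi_pos], by linarith [Real.pi_pos]⟩

/-- The cone function at a point far out on the positive axis is smaller than at any later one. -/
lemma exists_coneForm_strictMono (h₁ : SmallAtInfinity E₁) (h₂ : SmallAtInfinity E₂) :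
    ∃ R > 0, ∀ F V : ℂ → ℂ, PlaneSystem E₁ E₂ F V → ∀ s t : ℝ, R ≤ s → s < t →
      coneForm 1 (F s) (V s) < coneForm 1 (F t) (V t) := by
  obtain ⟨R, hR⟩ := exists_coneForm_lt_of_segment h₁ h₂ (c := 1) one_pos
  refine ⟨max R 1, by positivity, fun F V h s t hs hst => ?_⟩
  have hR' := (le_max_left R 1).trans hs
  have h1 : 1 ≤ s := (le_max_right R 1).trans hs
  have e : (t : ℂ) - s = ((t - s : ℝ) : ℂ) := by push_cast; ring
  refine hR F V h s t (by exact_mod_cast hst.ne) ?_ fun τ hτ => ?_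
  · rw [e, Complex.norm_real, Complex.ofReal_re, Real.norm_of_nonneg (by linarith), one_mul]
  · have hre : s ≤ ((s : ℂ) + τ * ((t : ℂ) - s)).re := by
      rw [e, ← Complex.ofReal_mul, ← Complex.ofReal_add, Complex.ofReal_re]
      have := mul_nonneg hτ.1 (sub_nonneg.2 hst.le)
      linarith
    exact ⟨Or.inl (by linarith), hR'.trans (hre.trans (Complex.re_le_norm _))⟩

/-- Far out on the positive axis, the data `F = V = 1` belong to a growing solution. -/
lemma exists_growing_data (h₁ : SmallAtInfinity E₁) (h₂ : SmallAtInfinity E₂) :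
    ∃ s : ℝ, 0 < s ∧ ∀ F V : ℂ → ℂ, PlaneSystem E₁ E₂ F V → F s = 1 → V s = 1 →
      RatioTendsto 1 (fun t => F (polarPoint 0 t)) (fun t => V (polarPoint 0 t)) := by
  obtain ⟨R, hR0, hR⟩ := exists_coneForm_strictMono h₁ h₂
  refine ⟨R, hR0, fun F V h hF hV => ?_⟩
  refine (h.ratioTendsto h₁ h₂ (cos_pos_and_mem_Ioo zero_mem_right_angles).2
    (by simp)).resolve_right fun hdec => ?_
  obtain ⟨t, ht, htR⟩ := (hdec.eventually_coneForm_neg.and (eventually_gt_atTop R)).exists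
  -- The form is nonnegative at R and increases afterwards, whereas decay would make it negative.
  have h1 := hR F V h R t le_rfl htR
  rw [hF, hV] at h1
  rw [polarPoint_zero] at ht
  have h2 : 0 ≤ coneForm 1 1 1 := by simp [coneForm]
  linarith

/-- A two-dimensional space of solutions contains one that decays on the positive axis. -/
lemma exists_decaying_combination (h₁ : SmallAtInfinity E₁) (h₂ : SmallAtInfinity E₂)
    {F₁ V₁ F₂ V₂ : ℂ → ℂ}
    (h : ∀ c : ℂ × ℂ, c ≠ 0 → PlaneSystem E₁ E₂ (fun w => c.1 * F₁ w + c.2 * F₂ w)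
      (fun w => c.1 * V₁ w + c.2 * V₂ w)) :
    ∃ c : ℂ × ℂ, c ≠ 0 ∧
      RatioTendsto (-1) (fun t => c.1 * F₁ (polarPoint 0 t) + c.2 * F₂ (polarPoint 0 t))
        (fun t => c.1 * V₁ (polarPoint 0 t) + c.2 * V₂ (polarPoint 0 t)) := by
  obtain ⟨R, hR0, hR⟩ := exists_coneForm_strictMono h₁ h₂
  -- One linear condition on two coefficients; normalising to the unit sphere keeps the limit
  -- nonzero.
  have hex : ∀ n : ℕ, ∃ c ∈ Metric.sphere (0 : ℂ × ℂ) 1,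
      c.1 * F₁ (n : ℝ) + c.2 * F₂ (n : ℝ) = 0 := by
    intro n
    obtain ⟨b, hb, hb0⟩ : ∃ b : ℂ × ℂ, b ≠ 0 ∧ b.1 * F₁ (n : ℝ) + b.2 * F₂ (n : ℝ) = 0 := by
      by_cases h0 : F₁ (n : ℝ) = 0
      · exact ⟨(1, 0), by simp, by rw [h0]; ring⟩
      · exact ⟨(F₂ (n : ℝ), -F₁ (n : ℝ)), fun h' => h0 (neg_eq_zero.1 (congrArg Prod.snd h')), by ring⟩
    refine ⟨((‖b‖⁻¹ : ℝ) : ℂ) • b, ?_, ?_⟩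
    · rw [mem_sphere_zero_iff_norm, norm_smul, Complex.norm_real, norm_inv, norm_norm,
        inv_mul_cancel₀ (norm_ne_zero_iff.2 hb)]
    · simp only [Prod.smul_fst, Prod.smul_snd, smul_eq_mul]
      linear_combination ((‖b‖⁻¹ : ℝ) : ℂ) * hb0
  choose c hc hc0 using hex
  have hne : ∀ b ∈ Metric.sphere (0 : ℂ × ℂ) 1, b ≠ 0 := fun b hb h0 => by
    simp [h0] at hb
  obtain ⟨b, hb, ψ, hψ, hlim⟩ := (isCompact_sphere (0 : ℂ × ℂ) 1).tendsto_subseq hc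
  refine ⟨b, hne b hb, ?_⟩
  refine ((h b (hne b hb)).ratioTendsto h₁ h₂ (cos_pos_and_mem_Ioo zero_mem_right_angles).2
    (by simp)).resolve_left fun hgrow => ?_
  obtain ⟨t, ht, htR⟩ := (hgrow.eventually_coneForm_pos.and (eventually_ge_atTop R)).exists
  simp only [polarPoint_zero] at ht
  refine ht.not_ge ?_
  have hcont : Continuous fun b : ℂ × ℂ =>
      coneForm 1 (b.1 * F₁ t + b.2 * F₂ t) (b.1 * V₁ t + b.2 * V₂ t) := by
    unfold coneForm; fun_prop
  refine le_of_tendsto ((hcont.tendsto b).comp hlim) ?_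
  have hbig : Tendsto (fun k => ((ψ k : ℕ) : ℝ)) atTop atTop :=
    tendsto_natCast_atTop_atTop.comp hψ.tendsto_atTop
  filter_upwards [hbig.eventually (eventually_gt_atTop t)] with k hk
  -- Where F = 0 the form is |V|² - |V|² = 0, so it is negative at the earlier point t. The limit
  -- solution inherits a form ≤ 0 and cannot grow.
  have h3 := hR _ _ (h (c (ψ k)) (hne _ (hc _))) t _ htR hk
  rw [hc0 (ψ k)] at h3
  simp only [coneForm, zero_add, zero_sub, norm_neg, one_mul, sub_self] at h3
  simpa only [Function.comp_apply, coneForm, one_mul] using h3.le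

end

/-! ### The coordinate that straightens a sector. -/

section

variable (P : Polynomial ℂ)

lemma q_pos : 0 < q P := by unfold q; positivity

/-- The modulus `√|p_n| / q` of `d`. -/
noncomputable def dNorm : ℝ := Real.sqrt ‖P.leadingCoeff‖ / q P

/-- The angle of the bisector of the sector `S(θ_{j-1}, θ_j)`. -/
noncomputable def midAngle (j : ℤ) : ℝ :=
  (Real.pi * (j - 1 / 2) - P.leadingCoeff.arg / 2) / q P

lemma q_mul_midAngle (j : ℤ) :
    q P * midAngle P j = Real.pi * (j - 1 / 2) - P.leadingCoeff.arg / 2 := by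
  have := (q_pos P).ne'
  rw [midAngle]; field_simp

lemma criticalAngle_eq (j : ℤ) : criticalAngle P j = midAngle P j + Real.pi / 2 / q P := by
  have : (P.natDegree : ℝ) + 2 ≠ 0 := by positivity
  rw [criticalAngle, midAngle, q]; field_simp; ring

lemma criticalAngle_sub_one_eq (j : ℤ) :
    criticalAngle P (j - 1) = midAngle P j - Real.pi / 2 / q P := by
  have : (P.natDegree : ℝ) + 2 ≠ 0 := by positivity
  rw [criticalAngle, midAngle, q]; push_cast; field_simp; ring

lemma mem_sectorAngles_iff {j : ℤ} {θ : ℝ} : θ ∈ sectorAngles P j ↔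
    q P * (θ - midAngle P j) ∈ Set.Ioo (-(Real.pi / 2)) (Real.pi / 2) := by
  have hq := q_pos P
  rw [sectorAngles, criticalAngle_sub_one_eq, criticalAngle_eq, Set.mem_Ioo, Set.mem_Ioo,
    ← div_lt_iff₀' hq, ← lt_div_iff₀' hq, neg_div]
  constructor <;> rintro ⟨h1, h2⟩ <;> constructor <;> linarith

/-- The inverse of the coordinate `w = (-1)^j i d z^q` on the sector `S(θ_{j-1}, θ_j)`, which is
the image of the right half-plane. -/
noncomputable def coordMap (j : ℤ) (w : ℂ) : ℂ :=
  polarPoint (midAngle P j) (dNorm P ^ (-(q P)⁻¹)) * Complex.exp (Complex.log w / q P)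

lemma hasDerivAt_coordMap (j : ℤ) {w : ℂ} (hw : w ∈ Complex.slitPlane) :
    HasDerivAt (coordMap P j) (coordMap P j w / (q P * w)) w := by
  have := (((Complex.hasDerivAt_log hw).div_const (q P : ℂ)).cexp).const_mul
    (polarPoint (midAngle P j) (dNorm P ^ (-(q P)⁻¹)))
  refine this.congr_deriv ?_
  rw [coordMap]
  field_simp

variable {P} (hP : P ≠ 0)
include hP

lemma dNorm_pos : 0 < dNorm P := by
  have h1 := q_pos P
  have h2 : 0 < ‖P.leadingCoeff‖ := norm_pos_iff.2 (Polynomial.leadingCoeff_ne_zero.2 hP)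
  unfold dNorm
  positivity

lemma coordMap_ne_zero (j : ℤ) (w : ℂ) : coordMap P j w ≠ 0 := by
  have h : 0 < dNorm P ^ (-(q P)⁻¹) := Real.rpow_pos_of_pos (dNorm_pos hP) _
  refine mul_ne_zero (mul_ne_zero ?_ (Complex.exp_ne_zero _)) (Complex.exp_ne_zero _)
  exact_mod_cast h.ne'

/-- The power 1/q divides the angle by q, and the constant factor cancels the modulus of d.
Statements on rays in w pass to rays in z through this identity. -/
lemma coordMap_polarPoint (j : ℤ) {φ r : ℝ} (hr : 0 < r)
    (hφ : φ ∈ Set.Ioo (-Real.pi) Real.pi) :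
    coordMap P j (polarPoint φ (dNorm P * r ^ q P)) = polarPoint (midAngle P j + φ / q P) r := by
  have hd := dNorm_pos hP
  have hq := q_pos P
  have hrq : 0 < r ^ q P := Real.rpow_pos_of_pos hr _
  have ht : 0 < dNorm P * r ^ q P := by positivity
  have hlog : Complex.log (polarPoint φ (dNorm P * r ^ q P)) =
      ((Real.log (dNorm P * r ^ q P) : ℝ) : ℂ) + φ * Complex.I := by
    rw [Complex.log, norm_polarPoint ht.le, arg_polarPoint ht hφ]
  have hsplit : (((Real.log (dNorm P * r ^ q P) : ℝ) : ℂ) + φ * Complex.I) / q P =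
      ((Real.log (dNorm P * r ^ q P) * (q P)⁻¹ : ℝ) : ℂ) + ((φ / q P : ℝ) : ℂ) * Complex.I := by
    push_cast; ring
  have hrad : dNorm P ^ (-(q P)⁻¹) * Real.exp (Real.log (dNorm P * r ^ q P) * (q P)⁻¹) = r := by
    rw [← Real.rpow_def_of_pos ht, Real.mul_rpow hd.le hrq.le, ← mul_assoc,
      ← Real.rpow_add hd, neg_add_cancel, Real.rpow_zero, one_mul, Real.rpow_rpow_inv hr.le hq.ne']
  rw [coordMap, hlog, hsplit, Complex.exp_add, ← Complex.ofReal_exp, polarPoint, polarPoint]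
  conv_rhs => rw [← hrad]
  push_cast
  rw [add_mul, Complex.exp_add]
  ring

/-- Since n + 2 = 2q, the power w^{1/q} becomes w² whatever the branch, and the constants of
`coordMap` turn the leading coefficient into -q². With dz/dw = z/(qw) this says that -p_n z^n
(dz/dw)² = 1. -/
lemma leadingCoeff_mul_coordMap_pow (j : ℤ) {w : ℂ} (hw : w ≠ 0) :
    P.leadingCoeff * coordMap P j w ^ (P.natDegree + 2) = -(q P * w) ^ 2 := by
  have hd := dNorm_pos hP
  have hq := q_pos P
  have hN : ((P.natDegree + 2 : ℕ) : ℝ) = 2 * q P := by rw [q]; push_cast; ring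
  have hNc : ((P.natDegree + 2 : ℕ) : ℂ) = 2 * (q P : ℂ) := by exact_mod_cast hN
  have hqc : (q P : ℂ) ≠ 0 := by exact_mod_cast hq.ne'
  have e1 : Complex.exp (Complex.log w / q P) ^ (P.natDegree + 2) = w ^ 2 := by
    rw [← Complex.exp_nat_mul, hNc]
    have : 2 * (q P : ℂ) * (Complex.log w / q P) = (2 : ℕ) * Complex.log w := by
      push_cast; field_simp
    rw [this, Complex.exp_nat_mul, Complex.exp_log hw]
  have e2 : (dNorm P ^ (-(q P)⁻¹)) ^ (P.natDegree + 2) = q P ^ 2 / ‖P.leadingCoeff‖ := by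
    rw [← Real.rpow_natCast, ← Real.rpow_mul hd.le, hN]
    have : -(q P)⁻¹ * (2 * q P) = -((2 : ℕ) : ℝ) := by push_cast; field_simp
    rw [this, Real.rpow_neg hd.le, Real.rpow_natCast, dNorm, div_pow,
      Real.sq_sqrt (norm_nonneg _), inv_div]
  have e3 : Complex.exp (midAngle P j * Complex.I) ^ (P.natDegree + 2) =
      -Complex.exp (-(P.leadingCoeff.arg * Complex.I)) := by
    rw [← Complex.exp_nat_mul, hNc]
    have h1 : 2 * (q P : ℂ) * (midAngle P j * Complex.I) =
        -(P.leadingCoeff.arg * Complex.I) + -(Real.pi * Complex.I) + j * (2 * Real.pi * Complex.I) := by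
      have := q_mul_midAngle P j
      have hc : (q P : ℂ) * midAngle P j = Real.pi * (j - 1 / 2) - P.leadingCoeff.arg / 2 := by
        have h := congrArg Complex.ofReal this
        push_cast at h
        exact h
      linear_combination 2 * Complex.I * hc
    rw [h1, Complex.exp_add, Complex.exp_add, Complex.exp_int_mul_two_pi_mul_I,
      Complex.exp_neg (Real.pi * Complex.I), Complex.exp_pi_mul_I]
    norm_num
  have hn : (‖P.leadingCoeff‖ : ℂ) ≠ 0 := by
    exact_mod_cast (norm_pos_iff.2 (Polynomial.leadingCoeff_ne_zero.2 hP)).ne'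
  have e2' : ((dNorm P ^ (-(q P)⁻¹) : ℝ) : ℂ) ^ (P.natDegree + 2) =
      (q P : ℂ) ^ 2 / ‖P.leadingCoeff‖ := by exact_mod_cast congrArg Complex.ofReal e2
  have hlead : P.leadingCoeff * Complex.exp (-(P.leadingCoeff.arg * Complex.I)) =
      ‖P.leadingCoeff‖ := by
    conv_lhs => rw [← Complex.norm_mul_exp_arg_mul_I P.leadingCoeff]
    rw [Complex.norm_mul_exp_arg_mul_I, Complex.exp_neg]
    nth_rewrite 1 [← Complex.norm_mul_exp_arg_mul_I P.leadingCoeff]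
    rw [mul_assoc, mul_inv_cancel₀ (Complex.exp_ne_zero _), mul_one]
  rw [coordMap, polarPoint, mul_pow, mul_pow, e1, e2', e3]
  linear_combination (-((q P : ℂ) ^ 2 / ‖P.leadingCoeff‖) * w ^ 2) * hlead -
    (q P : ℂ) ^ 2 * w ^ 2 * div_self hn

/-- Taking norms in the previous identity gives |p_n||z|^{n+2} = (q|w|)², and q|w| ≥ A + 1 already
makes the right side exceed A. -/
lemma exists_le_norm_coordMap (j : ℤ) (B : ℝ) :
    ∃ R > 0, ∀ w : ℂ, R ≤ ‖w‖ → B ≤ ‖coordMap P j w‖ := by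
  have hq := q_pos P
  set l := ‖P.leadingCoeff‖ with hl
  have hl0 : 0 < l := norm_pos_iff.2 (Polynomial.leadingCoeff_ne_zero.2 hP)
  set A : ℝ := l * (|B| + 1) ^ (P.natDegree + 2) with hA
  refine ⟨(A + 1) / q P, by positivity, fun w hw => ?_⟩
  have hw0 : w ≠ 0 := by
    rintro rfl
    have : 0 < (A + 1) / q P := by positivity
    rw [norm_zero] at hw; linarith
  have h := congrArg norm (leadingCoeff_mul_coordMap_pow hP j hw0)
  rw [norm_neg, norm_mul, norm_pow, norm_pow, norm_mul, Complex.norm_real,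
    Real.norm_of_nonneg hq.le, ← hl] at h
  rw [div_le_iff₀' hq] at hw
  by_contra! hlt
  have h1 : l * ‖coordMap P j w‖ ^ (P.natDegree + 2) ≤ A := by
    rw [hA]; gcongr
    linarith [le_abs_self B]
  have h2 : 0 ≤ A := by positivity
  nlinarith

variable (P) in
omit hP in
/-- The relative deviation of `P` from its leading monomial in the coordinate `w`. -/
noncomputable def leadError (j : ℤ) (w : ℂ) : ℂ :=
  P.eval (coordMap P j w) / (P.leadingCoeff * coordMap P j w ^ P.natDegree) - 1

variable (P) in
omit hP in
/-- The coefficient of the first derivative in the coordinate `w`. -/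
noncomputable def dampingCoeff (w : ℂ) : ℂ := ((q P : ℂ)⁻¹ - 1) / w

lemma smallAtInfinity_leadError (j : ℤ) : SmallAtInfinity (leadError P j) := by
  intro η hη
  have h := (Polynomial.isEquivalent_cobounded_leading_monomial (P := P)).isLittleO.bound hη
  obtain ⟨B, -, hB⟩ := (hasBasis_cobounded_norm (E := ℂ)).eventually_iff.1 h
  obtain ⟨R, -, hR⟩ := exists_le_norm_coordMap hP j B
  refine ⟨R, fun w _ hw => ?_⟩
  have h1 := hB (hR w hw)
  have hne : P.leadingCoeff * coordMap P j w ^ P.natDegree ≠ 0 :=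
    mul_ne_zero (Polynomial.leadingCoeff_ne_zero.2 hP) (pow_ne_zero _ (coordMap_ne_zero hP j w))
  rw [leadError, div_sub_one hne, norm_div, div_le_iff₀ (norm_pos_iff.2 hne)]
  exact h1

omit hP in
lemma smallAtInfinity_dampingCoeff : SmallAtInfinity (dampingCoeff P) := by
  intro η hη
  refine ⟨‖(q P : ℂ)⁻¹ - 1‖ / η, fun w hw hR => ?_⟩
  have hw0 := norm_pos_iff.2 (Complex.slitPlane_ne_zero hw)
  rw [dampingCoeff, norm_div, div_le_iff₀ hw0]
  rwa [div_le_iff₀' hη] at hR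

/-- In the coordinate `w`, a solution becomes a solution of `F'' = (1 + E₁) F + E₂ F'`. -/
lemma IsNontrivialSolution.planeSystem {f : ℂ → ℂ} (hf : IsNontrivialSolution P f) (j : ℤ) :
    PlaneSystem (leadError P j) (dampingCoeff P) (fun w => f (coordMap P j w))
      (fun w => deriv f (coordMap P j w) * (coordMap P j w / (q P * w))) := by
  obtain ⟨hd, hode, hne⟩ := hf
  have hqc : (q P : ℂ) ≠ 0 := by exact_mod_cast (q_pos P).ne'
  refine ⟨fun w hw => ?_, fun w hw => ?_, fun w hw => ?_⟩
  · exact (hd _).hasDerivAt.comp w (hasDerivAt_coordMap P j hw)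
  · have hw0 := Complex.slitPlane_ne_zero hw
    have hZ := hasDerivAt_coordMap P j hw
    have hden : HasDerivAt (fun w : ℂ => (q P : ℂ) * w) (q P) w := by
      simpa using (hasDerivAt_id w).const_mul (q P : ℂ)
    have h1 := ((hd.deriv _).hasDerivAt.comp w hZ).mul (hZ.div hden (mul_ne_zero hqc hw0))
    refine h1.congr_deriv ?_
    have h2 : deriv (deriv f) (coordMap P j w) =
        -(P.eval (coordMap P j w) * f (coordMap P j w)) := eq_neg_of_add_eq_zero_left (hode _)
    have h3 := leadingCoeff_mul_coordMap_pow hP j hw0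
    have hZ0 := coordMap_ne_zero hP j w
    have hl := Polynomial.leadingCoeff_ne_zero.2 hP
    -- The coefficient of F is -P(z)(dz/dw)², and the leading monomial contributes exactly 1 to it.
    have h4 : 1 + leadError P j w = -(P.eval (coordMap P j w)) *
        (coordMap P j w / (q P * w)) ^ 2 := by
      rw [leadError, add_sub_cancel, div_eq_iff (mul_ne_zero hl (pow_ne_zero _ hZ0)), div_pow]
      rw [pow_add] at h3
      field_simp
      linear_combination (P.eval (coordMap P j w)) * h3
    simp only [Function.comp_apply, Pi.div_apply]
    rw [h2, h4, dampingCoeff]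
    field_simp
  · by_contra! hzero
    have hfac : coordMap P j w / (q P * w) ≠ 0 :=
      div_ne_zero (coordMap_ne_zero hP j w) (mul_ne_zero hqc (Complex.slitPlane_ne_zero hw))
    exact hne (eq_zero_of_initial hd hode hzero.1
      ((mul_eq_zero.1 hzero.2).resolve_right hfac))

end

/-! ### Back to the rays in the z-plane. -/

lemma log_enorm_exp (z : ℂ) : ENNReal.log ‖Complex.exp z‖ₑ = (z.re : EReal) := by
  rw [← ofReal_norm, Complex.norm_exp, ENNReal.log_ofReal_of_pos (Real.exp_pos _),
    Real.log_exp]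

variable {P : Polynomial ℂ}

lemma neg_one_zpow_mul_self (j : ℤ) : (-1 : ℂ) ^ j * (-1) ^ j = 1 := by
  rcases Int.even_or_odd j with h | h
  · rw [h.neg_one_zpow]; norm_num
  · rw [h.neg_one_zpow]; norm_num

/-- The exponent `i d z^q` in the coordinate of the sector `S(θ_{j-1}, θ_j)`. -/
lemma I_mul_d_mul_powQ (j : ℤ) (φ r : ℝ) :
    Complex.I * d P * powQ P (midAngle P j + φ / q P) r =
      (-1) ^ j * (Complex.exp (φ * Complex.I) * ((dNorm P * r ^ q P : ℝ) : ℂ)) := by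
  have hq := (q_pos P).ne'
  have hqc : (q P : ℂ) ≠ 0 := by exact_mod_cast hq
  have h1 : q P * (midAngle P j + φ / q P) =
      Real.pi * (j - 1 / 2) - P.leadingCoeff.arg / 2 + φ := by
    rw [mul_add, q_mul_midAngle]; field_simp
  have h2 : Complex.exp (Complex.I * (P.leadingCoeff.arg : ℂ) / 2) *
      Complex.exp (Complex.I * ((Real.pi * (j - 1 / 2) - P.leadingCoeff.arg / 2 + φ : ℝ) : ℂ)) =
      -Complex.I * ((-1) ^ j * Complex.exp (φ * Complex.I)) := by
    have e : Complex.I * (P.leadingCoeff.arg : ℂ) / 2 +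
        Complex.I * ((Real.pi * (j - 1 / 2) - P.leadingCoeff.arg / 2 + φ : ℝ) : ℂ) =
        -(Real.pi / 2 * Complex.I) + (j * (Real.pi * Complex.I) + φ * Complex.I) := by
      push_cast; ring
    rw [← Complex.exp_add, e, Complex.exp_add, Complex.exp_add, Complex.exp_int_mul,
      Complex.exp_pi_mul_I, Complex.exp_neg, Complex.exp_pi_div_two_mul_I, Complex.inv_I]
  rw [d, powQ, h1, dNorm]
  push_cast at h2 ⊢
  field_simp at h2 ⊢
  linear_combination (Complex.I * (√‖P.leadingCoeff‖ : ℂ) * ((r ^ q P : ℝ) : ℂ)) * h2 -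
    ((√‖P.leadingCoeff‖ : ℂ) * ((r ^ q P : ℝ) : ℂ) * (-1) ^ j *
      Complex.exp (Complex.I * φ)) * Complex.I_sq

/-- The type `σ` of a solution on the ray `arg w = φ` in the coordinate of the sector
`S(θ_{j-1}, θ_j)`. -/
def HasRayType (P : Polynomial ℂ) (f : ℂ → ℂ) (j : ℤ) (σ : ℂ) (φ : ℝ) : Prop :=
  RatioTendsto σ (fun t => f (coordMap P j (polarPoint φ t)))
    (fun t => deriv f (coordMap P j (polarPoint φ t)) *
      (coordMap P j (polarPoint φ t) / (q P * polarPoint φ t)))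

section

variable {f : ℂ → ℂ} {j : ℤ} {φ : ℝ}

lemma IsNontrivialSolution.exists_exp_form (hf : IsNontrivialSolution P f) (hP : P ≠ 0) {σ : ℂ}
    (hφ : φ ∈ Set.Ioo (-Real.pi) Real.pi) (hσ : σ ≠ 0) (h : HasRayType P f j σ φ) :
    ∃ ε : ℝ → ℂ, Tendsto ε atTop (𝓝 0) ∧ ∀ᶠ r : ℝ in atTop,
      f (polarPoint (midAngle P j + φ / q P) r) = Complex.exp
        (σ * (Complex.exp (φ * Complex.I) * ((dNorm P * r ^ q P : ℝ) : ℂ)) * (1 + ε r)) := by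
  obtain ⟨ε, hε, hev⟩ := ((hf.planeSystem hP j).raySystem (smallAtInfinity_leadError hP j)
    smallAtInfinity_dampingCoeff hφ).exists_exp_form (Complex.exp_ne_zero _) hσ h
  have ht : Tendsto (fun r : ℝ => dNorm P * r ^ q P) atTop atTop :=
    (tendsto_rpow_atTop (q_pos P)).const_mul_atTop (dNorm_pos hP)
  refine ⟨fun r => ε (dNorm P * r ^ q P), hε.comp ht, ?_⟩
  filter_upwards [ht.eventually hev, eventually_gt_atTop 0] with r hr hr0
  rw [coordMap_polarPoint hP j hr0 hφ] at hr
  rw [hr]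
  congr 1
  ring

lemma IsNontrivialSolution.asymptoticOnRay (hf : IsNontrivialSolution P f) (hP : P ≠ 0) {σ : ℂ}
    (hφ : φ ∈ Set.Ioo (-Real.pi) Real.pi) (hσ : σ ≠ 0) (h : HasRayType P f j σ φ) :
    AsymptoticOnRay P (σ * (-1) ^ j) f (midAngle P j + φ / q P) := by
  obtain ⟨ε, hε, hev⟩ := hf.exists_exp_form hP hφ hσ h
  refine ⟨ε, hε, hev.mono fun r hr => ?_⟩
  rw [hr]
  congr 1
  have h1 := I_mul_d_mul_powQ (P := P) j φ r
  have h2 := neg_one_zpow_mul_self j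
  linear_combination (-(σ * (-1) ^ j * (1 + ε r))) * h1 -
    (σ * (Complex.exp (φ * Complex.I) * ((dNorm P * r ^ q P : ℝ) : ℂ)) * (1 + ε r)) * h2

/-- The exponential form yields genuine limits, so each liminf is known exactly and its sign is that
of ±σ cos φ. -/
lemma IsNontrivialSolution.tendsto_log (hf : IsNontrivialSolution P f) (hP : P ≠ 0) {σ : ℝ}
    (hφ : φ ∈ Set.Ioo (-Real.pi) Real.pi) (hσ : σ ≠ 0) (h : HasRayType P f j σ φ) :
    Tendsto (fun r : ℝ => ((r ^ (-q P) : ℝ) : EReal) *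
        ENNReal.log ‖f (polarPoint (midAngle P j + φ / q P) r)‖ₑ) atTop
      (𝓝 ((σ * Real.cos φ * dNorm P : ℝ) : EReal)) ∧
    Tendsto (fun r : ℝ => ((r ^ (-q P) : ℝ) : EReal) *
        ENNReal.log (‖f (polarPoint (midAngle P j + φ / q P) r)‖ₑ)⁻¹) atTop
      (𝓝 ((-(σ * Real.cos φ * dNorm P) : ℝ) : EReal)) := by
  obtain ⟨ε, hε, hev⟩ := hf.exists_exp_form hP hφ (by exact_mod_cast hσ) h
  have hlim : Tendsto (fun r => (σ * Complex.exp (φ * Complex.I) * (1 + ε r)).re * dNorm P) atTop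
      (𝓝 (σ * Real.cos φ * dNorm P)) := by
    have h1 : Tendsto (fun r => σ * Complex.exp (φ * Complex.I) * (1 + ε r)) atTop
        (𝓝 (σ * Complex.exp (φ * Complex.I) * (1 + 0))) := (hε.const_add 1).const_mul _
    have h2 := ((Complex.continuous_re.tendsto _).comp h1).mul_const (dNorm P)
    rwa [add_zero, mul_one, Complex.re_ofReal_mul, Complex.exp_ofReal_mul_I_re] at h2
  have hlog : ∀ᶠ r : ℝ in atTop, ENNReal.log ‖f (polarPoint (midAngle P j + φ / q P) r)‖ₑ =
      ((r ^ q P * ((σ * Complex.exp (φ * Complex.I) * (1 + ε r)).re * dNorm P) : ℝ) : EReal) := by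
    filter_upwards [hev] with r hr
    rw [hr, log_enorm_exp]
    congr 1
    have : σ * (Complex.exp (φ * Complex.I) * ((dNorm P * r ^ q P : ℝ) : ℂ)) * (1 + ε r) =
        ((dNorm P * r ^ q P : ℝ) : ℂ) * (σ * Complex.exp (φ * Complex.I) * (1 + ε r)) := by ring
    rw [this, Complex.re_ofReal_mul]
    ring
  have hcancel : ∀ r : ℝ, 0 < r → ∀ x : ℝ, r ^ (-q P) * (r ^ q P * x) = x := fun r hr x => by
    rw [← mul_assoc, ← Real.rpow_add hr, neg_add_cancel, Real.rpow_zero, one_mul]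
  constructor
  · refine (EReal.tendsto_coe.2 hlim).congr' ?_
    filter_upwards [hlog, eventually_gt_atTop 0] with r hr hr0
    rw [hr, ← EReal.coe_mul, hcancel r hr0]
  · refine (EReal.tendsto_coe.2 hlim.neg).congr' ?_
    filter_upwards [hlog, eventually_gt_atTop 0] with r hr hr0
    rw [ENNReal.log_inv, hr, ← EReal.coe_neg, ← EReal.coe_mul, mul_neg, hcancel r hr0]

lemma IsNontrivialSolution.blowsUpOnRay_iff (hf : IsNontrivialSolution P f) (hP : P ≠ 0) {σ : ℝ}
    (hφ : φ ∈ Set.Ioo (-Real.pi) Real.pi) (hσ : σ ≠ 0) (h : HasRayType P f j σ φ) :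
    BlowsUpOnRay P f (midAngle P j + φ / q P) ↔ 0 < σ * Real.cos φ := by
  rw [BlowsUpOnRay, (hf.tendsto_log hP hφ hσ h).1.liminf_eq, EReal.coe_pos,
    mul_pos_iff_of_pos_right (dNorm_pos hP)]

lemma IsNontrivialSolution.decaysOnRay_iff (hf : IsNontrivialSolution P f) (hP : P ≠ 0) {σ : ℝ}
    (hφ : φ ∈ Set.Ioo (-Real.pi) Real.pi) (hσ : σ ≠ 0) (h : HasRayType P f j σ φ) :
    DecaysOnRay P f (midAngle P j + φ / q P) ↔ σ * Real.cos φ < 0 := by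
  rw [DecaysOnRay, (hf.tendsto_log hP hφ hσ h).2.liminf_eq, EReal.coe_pos, neg_pos,
    ← not_le, mul_nonneg_iff_of_pos_right (dNorm_pos hP), not_le]

lemma IsNontrivialSolution.hasRayType_or (hf : IsNontrivialSolution P f) (hP : P ≠ 0) (j : ℤ)
    (hφ : φ ∈ Set.Ioo (-Real.pi) Real.pi) (hcos : Real.cos φ ≠ 0) :
    HasRayType P f j ((1 : ℝ) : ℂ) φ ∨ HasRayType P f j ((-1 : ℝ) : ℂ) φ := by
  have := (hf.planeSystem hP j).ratioTendsto (smallAtInfinity_leadError hP j)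
    smallAtInfinity_dampingCoeff hφ hcos
  simpa [HasRayType] using this

lemma IsNontrivialSolution.hasRayType_neg_one_of (hf : IsNontrivialSolution P f) (hP : P ≠ 0)
    {φ₀ : ℝ} (hφ₀ : φ₀ ∈ Set.Ioo (-(Real.pi / 2)) (Real.pi / 2))
    (hφ : φ ∈ Set.Ioo (-(Real.pi / 2)) (Real.pi / 2)) (h : HasRayType P f j ((-1 : ℝ) : ℂ) φ₀) :
    HasRayType P f j ((-1 : ℝ) : ℂ) φ := by
  have e : ((-1 : ℝ) : ℂ) = -1 := by simp
  rw [e] at h ⊢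
  exact (hf.planeSystem hP j).ratioTendsto_neg_one (smallAtInfinity_leadError hP j)
    smallAtInfinity_dampingCoeff hφ₀ hφ h

lemma not_hasRayType_one_and_neg_one
    (h₁ : HasRayType P f j ((1 : ℝ) : ℂ) φ) (h₂ : HasRayType P f j ((-1 : ℝ) : ℂ) φ) : False := by
  have := tendsto_nhds_unique h₁.2 h₂.2
  norm_num at this

/-- All rays of the sector have the same type as any one of them. -/
lemma IsNontrivialSolution.hasRayType_of (hf : IsNontrivialSolution P f) (hP : P ≠ 0)
    {φ₀ σ : ℝ} (hσ : σ = 1 ∨ σ = -1) (hφ₀ : φ₀ ∈ Set.Ioo (-(Real.pi / 2)) (Real.pi / 2))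
    (hφ : φ ∈ Set.Ioo (-(Real.pi / 2)) (Real.pi / 2)) (h : HasRayType P f j σ φ₀) :
    HasRayType P f j σ φ := by
  rcases hσ with rfl | rfl
  · obtain ⟨hc, hφ'⟩ := cos_pos_and_mem_Ioo hφ
    -- Growth propagates because decay at φ would propagate back to φ₀.
    exact (hf.hasRayType_or hP j hφ' hc.ne').resolve_right fun h' =>
      not_hasRayType_one_and_neg_one h (hf.hasRayType_neg_one_of hP hφ hφ₀ h')
  · exact hf.hasRayType_neg_one_of hP hφ₀ hφ h

end

/-! ### Types of sectors. -/

lemma eq_midAngle_add (θ : ℝ) (j : ℤ) :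
    θ = midAngle P j + q P * (θ - midAngle P j) / q P := by
  have := (q_pos P).ne'
  field_simp; ring

/-- The type of a solution on a sector: `1` for growth, `-1` for decay. -/
def HasSectorType (P : Polynomial ℂ) (f : ℂ → ℂ) (j : ℤ) (σ : ℝ) : Prop :=
  HasRayType P f j σ 0

section

variable {f : ℂ → ℂ} {j : ℤ}

lemma IsNontrivialSolution.hasSectorType_or (hf : IsNontrivialSolution P f) (hP : P ≠ 0) (j : ℤ) :
    HasSectorType P f j 1 ∨ HasSectorType P f j (-1) :=
  hf.hasRayType_or hP j (cos_pos_and_mem_Ioo zero_mem_right_angles).2 (by simp)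

lemma HasSectorType.blowsUpOnRay (hf : IsNontrivialSolution P f) (hP : P ≠ 0)
    (h : HasSectorType P f j 1) {θ : ℝ} (hθ : θ ∈ sectorAngles P j) : BlowsUpOnRay P f θ := by
  rw [mem_sectorAngles_iff] at hθ
  obtain ⟨hc, hφ⟩ := cos_pos_and_mem_Ioo hθ
  rw [eq_midAngle_add (P := P) θ j, hf.blowsUpOnRay_iff hP hφ one_ne_zero
    (hf.hasRayType_of hP (Or.inl rfl) zero_mem_right_angles hθ h)]
  linarith

lemma HasSectorType.decaysOnRay (hf : IsNontrivialSolution P f) (hP : P ≠ 0)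
    (h : HasSectorType P f j (-1)) {θ : ℝ} (hθ : θ ∈ sectorAngles P j) : DecaysOnRay P f θ := by
  rw [mem_sectorAngles_iff] at hθ
  obtain ⟨hc, hφ⟩ := cos_pos_and_mem_Ioo hθ
  rw [eq_midAngle_add (P := P) θ j, hf.decaysOnRay_iff hP hφ (by norm_num)
    (hf.hasRayType_of hP (Or.inr rfl) zero_mem_right_angles hθ h)]
  linarith

lemma HasSectorType.of_decaysOnRay (hf : IsNontrivialSolution P f) (hP : P ≠ 0) {θ : ℝ}
    (hθ : θ ∈ sectorAngles P j) (h : DecaysOnRay P f θ) : HasSectorType P f j (-1) := by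
  refine (hf.hasSectorType_or hP j).resolve_left fun h1 => ?_
  rw [mem_sectorAngles_iff] at hθ
  obtain ⟨hc, hφ⟩ := cos_pos_and_mem_Ioo hθ
  rw [eq_midAngle_add (P := P) θ j, hf.decaysOnRay_iff hP hφ one_ne_zero
    (hf.hasRayType_of hP (Or.inl rfl) zero_mem_right_angles hθ h1)] at h
  linarith

lemma HasSectorType.asymptoticOnRay (hf : IsNontrivialSolution P f) (hP : P ≠ 0) {σ : ℝ}
    (hσ : σ = 1 ∨ σ = -1) (h : HasSectorType P f j σ) {θ : ℝ} (hθ : θ ∈ sectorAngles P j) :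
    AsymptoticOnRay P (σ * (-1) ^ j) f θ := by
  rw [mem_sectorAngles_iff] at hθ
  have hσ0 : (σ : ℂ) ≠ 0 := by rcases hσ with rfl | rfl <;> simp
  rw [eq_midAngle_add (P := P) θ j]
  exact hf.asymptoticOnRay hP (cos_pos_and_mem_Ioo hθ).2 hσ0
    (hf.hasRayType_of hP hσ zero_mem_right_angles hθ h)

lemma IsNontrivialSolution.asymptoticOnRay_or (hf : IsNontrivialSolution P f) (hP : P ≠ 0)
    (j : ℤ) : (∀ θ ∈ sectorAngles P j, AsymptoticOnRay P 1 f θ) ∨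
      (∀ θ ∈ sectorAngles P j, AsymptoticOnRay P (-1) f θ) := by
  obtain ⟨σ, hσ, h⟩ : ∃ σ : ℝ, (σ = 1 ∨ σ = -1) ∧ HasSectorType P f j σ := by
    rcases hf.hasSectorType_or hP j with h | h
    · exact ⟨1, Or.inl rfl, h⟩
    · exact ⟨-1, Or.inr rfl, h⟩
  have key := fun θ hθ => HasSectorType.asymptoticOnRay hf hP hσ h (θ := θ) hθ
  -- Since w = (-1)^j i d z^q, the parity of j decides which of E₁ and E₂ is the growing one.
  rcases Int.even_or_odd j with hj | hj <;> rcases hσ with rfl | rfl <;>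
    simp [hj.neg_one_zpow] at key <;> tauto

/-- In the coordinate of sector j the next sector is centred at arg w = π, and its nearer half lies
in the slit plane. Both sectors are thus visible in one coordinate, and one ray of each suffices. -/
lemma IsNontrivialSolution.not_decays_adjacent (hf : IsNontrivialSolution P f) (hP : P ≠ 0)
    {θ θ' : ℝ} (hθ : θ ∈ sectorAngles P j) (hθ' : θ' ∈ sectorAngles P (j + 1))
    (h : DecaysOnRay P f θ) (h' : DecaysOnRay P f θ') : False := by
  have hπ := Real.pi_pos
  have hq := q_pos P
  have hφ : Real.pi / 4 ∈ Set.Ioo (-(Real.pi / 2)) (Real.pi / 2) :=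
    ⟨by linarith, by linarith⟩
  have hψ : Real.pi - Real.pi / 4 ∈ Set.Ioo (-Real.pi) Real.pi := ⟨by linarith, by linarith⟩
  have hcos : 0 < Real.cos (Real.pi / 4) := (cos_pos_and_mem_Ioo hφ).1
  have hr := hf.hasRayType_of hP (Or.inr rfl) zero_mem_right_angles hφ
    (HasSectorType.of_decaysOnRay hf hP hθ h)
  have hmid : midAngle P (j + 1) = midAngle P j + Real.pi / q P := by
    rw [midAngle, midAngle]; push_cast; field_simp; ring
  -- The ray at angle 3π/4 in the coordinate of sector j has angle -π/4 in that of sector j + 1.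
  have hdec : DecaysOnRay P f (midAngle P j + (Real.pi - Real.pi / 4) / q P) := by
    refine (HasSectorType.of_decaysOnRay hf hP hθ' h').decaysOnRay hf hP ?_
    rw [mem_sectorAngles_iff, hmid]
    have : q P * (midAngle P j + (Real.pi - Real.pi / 4) / q P - (midAngle P j + Real.pi / q P)) =
        -(Real.pi / 4) := by field_simp; ring
    rw [this]
    exact ⟨by linarith, by linarith⟩
  have hl : HasRayType P f j ((1 : ℝ) : ℂ) (Real.pi - Real.pi / 4) := by
    refine (hf.hasRayType_or hP j hψ ?_).resolve_right fun h1 => ?_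
    · rw [Real.cos_pi_sub]; linarith
    · rw [hf.decaysOnRay_iff hP hψ (by norm_num) h1, Real.cos_pi_sub] at hdec
      linarith
  rw [HasRayType, Complex.ofReal_one] at hl
  rw [HasRayType, Complex.ofReal_neg, Complex.ofReal_one] at hr
  exact (hf.planeSystem hP j).not_decay_both_sides (smallAtInfinity_leadError hP j)
    smallAtInfinity_dampingCoeff hl hr

end

/-! ### Existence of both types. -/

lemma exists_hasSectorType_one (hP : P ≠ 0) (j : ℤ) :
    ∃ f : ℂ → ℂ, IsNontrivialSolution P f ∧ HasSectorType P f j 1 := by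
  obtain ⟨s, hs, hgrow⟩ := exists_growing_data (smallAtInfinity_leadError hP j)
    (smallAtInfinity_dampingCoeff (P := P))
  have hqc : (q P : ℂ) ≠ 0 := by exact_mod_cast (q_pos P).ne'
  have hsc : (s : ℂ) ≠ 0 := by exact_mod_cast hs.ne'
  have hZ := coordMap_ne_zero hP j s
  -- The derivative is the one that makes dF/dw = 1 at w = s.
  obtain ⟨f, hd, hode, h0, h1⟩ := exists_solution P (coordMap P j s) 1
    (q P * s / coordMap P j s)
  have hf : IsNontrivialSolution P f := ⟨hd, hode, fun h => by simp [h] at h0⟩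
  refine ⟨f, hf, ?_⟩
  rw [HasSectorType, HasRayType, Complex.ofReal_one]
  exact hgrow _ _ (hf.planeSystem hP j) h0 (by rw [h1]; field_simp)

lemma exists_hasSectorType_neg_one (hP : P ≠ 0) (j : ℤ) :
    ∃ f : ℂ → ℂ, IsNontrivialSolution P f ∧ HasSectorType P f j (-1) := by
  -- A fundamental pair: the initial data at 0 recover the coefficients, so every nonzero
  -- combination is non-trivial.
  obtain ⟨f₁, hd₁, hode₁, h10, h11⟩ := exists_solution P 0 1 0
  obtain ⟨f₂, hd₂, hode₂, h20, h21⟩ := exists_solution P 0 0 1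
  have hder : ∀ c : ℂ × ℂ, deriv (fun z => c.1 * f₁ z + c.2 * f₂ z) =
      fun z => c.1 * deriv f₁ z + c.2 * deriv f₂ z := fun c => funext fun z =>
    (((hd₁ z).hasDerivAt.const_mul c.1).add ((hd₂ z).hasDerivAt.const_mul c.2)).deriv
  have hsol : ∀ c : ℂ × ℂ, c ≠ 0 →
      IsNontrivialSolution P (fun z => c.1 * f₁ z + c.2 * f₂ z) := by
    refine fun c hc => ⟨by fun_prop, fun z => ?_, fun h => hc ?_⟩
    · have e : deriv (fun z => c.1 * deriv f₁ z + c.2 * deriv f₂ z) z =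
          c.1 * deriv (deriv f₁) z + c.2 * deriv (deriv f₂) z :=
        (((hd₁.deriv z).hasDerivAt.const_mul c.1).add
          ((hd₂.deriv z).hasDerivAt.const_mul c.2)).deriv
      rw [hder, e]
      linear_combination c.1 * hode₁ z + c.2 * hode₂ z
    · have h1 := congrFun h 0
      have h2 := congrFun (hder c) 0
      rw [h] at h2
      simp [h10, h20] at h1
      have h3 : deriv (0 : ℂ → ℂ) 0 = 0 := by simp
      rw [h3, h11, h21] at h2
      exact Prod.ext h1 (by simpa using h2.symm)
  obtain ⟨c, hc, hdec⟩ := exists_decaying_combination (smallAtInfinity_leadError hP j)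
    (smallAtInfinity_dampingCoeff (P := P))
    (F₁ := fun w => f₁ (coordMap P j w)) (F₂ := fun w => f₂ (coordMap P j w))
    (V₁ := fun w => deriv f₁ (coordMap P j w) * (coordMap P j w / (q P * w)))
    (V₂ := fun w => deriv f₂ (coordMap P j w) * (coordMap P j w / (q P * w)))
    (fun c hc => by
      have := (hsol c hc).planeSystem (fun h => hP h) j
      rw [hder] at this
      convert this using 2
      ring)
  refine ⟨_, hsol c hc, ?_⟩
  rw [HasSectorType, HasRayType, hder, Complex.ofReal_neg, Complex.ofReal_one]
  convert hdec using 2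
  ring

end PolyODE

theorem theorem1 (P : Polynomial ℂ) (hP : 1 ≤ P.natDegree) :
    -- the dichotomy in each sector, with the asymptotic form
    (∀ f : ℂ → ℂ, PolyODE.IsNontrivialSolution P f → ∀ j : ℤ,
      ((∀ θ ∈ PolyODE.sectorAngles P j, PolyODE.BlowsUpOnRay P f θ) ∨
        (∀ θ ∈ PolyODE.sectorAngles P j, PolyODE.DecaysOnRay P f θ)) ∧
      ((∀ θ ∈ PolyODE.sectorAngles P j, PolyODE.AsymptoticOnRay P 1 f θ) ∨
        (∀ θ ∈ PolyODE.sectorAngles P j, PolyODE.AsymptoticOnRay P (-1) f θ))) ∧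
    -- both types occur in each sector
    (∀ j : ℤ,
      (∃ f : ℂ → ℂ, PolyODE.IsNontrivialSolution P f ∧
        ∀ θ ∈ PolyODE.sectorAngles P j, PolyODE.BlowsUpOnRay P f θ) ∧
      (∃ f : ℂ → ℂ, PolyODE.IsNontrivialSolution P f ∧
        ∀ θ ∈ PolyODE.sectorAngles P j, PolyODE.DecaysOnRay P f θ)) ∧
    -- no decay on rays in two adjacent sectors
    (∀ f : ℂ → ℂ, PolyODE.IsNontrivialSolution P f → ∀ j : ℤ,
      ¬ ∃ θ ∈ PolyODE.sectorAngles P j, ∃ φ ∈ PolyODE.sectorAngles P (j + 1),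
        PolyODE.DecaysOnRay P f θ ∧ PolyODE.DecaysOnRay P f φ) := by
  have hP0 : P ≠ 0 := by
    rintro rfl
    simp at hP
  refine ⟨fun f hf j => ⟨?_, hf.asymptoticOnRay_or hP0 j⟩, fun j => ⟨?_, ?_⟩, ?_⟩
  · exact (hf.hasSectorType_or hP0 j).imp (fun h θ hθ => h.blowsUpOnRay hf hP0 hθ)
      fun h θ hθ => h.decaysOnRay hf hP0 hθ
  · obtain ⟨f, hf, h⟩ := PolyODE.exists_hasSectorType_one hP0 j
    exact ⟨f, hf, fun θ hθ => h.blowsUpOnRay hf hP0 hθ⟩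
  · obtain ⟨f, hf, h⟩ := PolyODE.exists_hasSectorType_neg_one hP0 j
    exact ⟨f, hf, fun θ hθ => h.decaysOnRay hf hP0 hθ⟩
  · rintro f hf j ⟨θ, hθ, φ, hφ, h, h'⟩
    exact hf.not_decays_adjacent hP0 hθ hφ h h'
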